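/- \textbf{Theorem.} Let $\Gamma$ be a Kleinian group, i.e. a discrete subgroup of $\mathrm{PSL}(2,\mathbb C)$, let $\Gamma_1\lhd\Gamma$ be a normal subgroup of finite index $n$, and let $s\in\mathbb C$ with $\operatorname{Re}s>1$ be such that the Euler product (defined below) of $Z(s,\Gamma,\mathbf 1)$ converges absolutely. Then the Euler products of $Z(s,\Gamma_1,\mathbf 1)$, of $Z(s,\Gamma,U^{\mathbf 1})$ and of all $Z(s,\Gamma,\vartheta)$, $\vartheta\in(\Gamma_1\backslash\Gamma)^*$, converge absolutely at $s$, the set $(\Gamma_1\backslash\Gamma)^*$ is finite, and $$Z(s,\Gamma_1,\mathbf 1)=Z(s,\Gamma,U^{\mathbf 1})=\prod_{\vartheta\in(\Gamma_1\backslash\Gamma)^*}Z(s,\Gamma,\vartheta)^{n_\vartheta}.$$ Here $\mathbf 1$ denotes the trivial one-dimensional representation; $(\Gamma_1\backslash\Gamma)^*$ is a complete set of pairwise inequivalent irreducible unitary representations of the finite group $\Gamma_1\backslash\Gamma$, regarded as representations of $\Gamma$ through the quotient map; $n_\vartheta=\dim\vartheta$. For a representation $\chi$ of $\Gamma_1$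 in $V$ and right coset representatives $\alpha_1,\dots,\alpha_n$ of $\Gamma_1\backslash\Gamma$, the induced representation $U^\chi$ of $\Gamma$ in $V^n$ is $(U^\chi(\gamma)v)_i=\sum_{j}\overline\chi(\alpha_i\gamma\alpha_j^{-1})v_j$, where $\overline\chi=\chi$ on $\Gamma_1$ and $\overline\chi=0$ off $\Gamma_1$. \emph{The zeta function.} An element $T$ of a Kleinian group $\Gamma$ is loxodromic if it is conjugate in $\mathrm{PSL}(2,\mathbb C)$ to $\mathrm{diag}(a,a^{-1})$ with $|a|>1$. A loxodromic $T_0\in\Gamma$ is primitive if its centralizer in $\Gamma$ is $\langle T_0\rangle\times\langle E\rangle$ with $E$ of finite order. In that case conjugate $T_0$ and $E$ simultaneously to $\mathrm{diag}(a(T_0),a(T_0)^{-1})$, $|a(T_0)|>1$, and $\mathrm{diag}(\zeta(T_0),\zeta(T_0)^{-1})$, and put $N(T_0)=|a(T_0)|^2$. Let $\mathcal R$ be a maximal reduced system of representatives of the $\Gamma$-conjugacy classes of primitive loxodromic elements, where reduced means that no two distinct members have $\Gamma$-conjugates with the same centralizer and the same attracting fixed point. For a finite-dimensional unitary representation $\chi$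 of $\Gamma$ in $V$ let $(\mathfrak t_j,\mathfrak t_j')$, $1\le j\le\dim V$, be the pairs of eigenvalues of $\chi(T_0)$ and $\chi(E)$ on a common eigenbasis. Then $$Z(s,\Gamma,\chi)=\prod_{T_0\in\mathcal R}\ \prod_{j=1}^{\dim V}\ \prod_{\substack{l,k\ge0\\ \mathfrak t_j'\zeta(T_0)^{2l-2k}=1}}\Bigl(1-\mathfrak t_j\,a(T_0)^{-2k}\,\overline{a(T_0)^{-2l}}\,N(T_0)^{-s-1}\Bigr),$$ and absolute convergence means that the sum of the absolute values of the terms subtracted from $1$ is finite. -/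

import Mathlib

open scoped MatrixGroups ComplexConjugate

noncomputable section

namespace SelbergZeta

/-- The diagonal matrix with entries `a, a⁻¹` in `SL(2, ℂ)`. -/
def diagSL (a : ℂˣ) : SL(2, ℂ) :=
  ⟨!![(a : ℂ), 0; 0, (a : ℂ)⁻¹], by simp [Matrix.det_fin_two]⟩

/-- The class of `diag(a, a⁻¹)` in `PSL(2, ℂ)`. -/
def diagPSL (a : ℂˣ) : PSL(2, ℂ) :=
  QuotientGroup.mk (diagSL a)

/-- `T` and `T'` are loxodromic (hyperbolic elements included) with the same axis and they
translate along it in the same direction: one conjugation in `PSL(2, ℂ)` takes them to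
`diag(a, a⁻¹)` and `diag(a', a'⁻¹)` with `|a| > 1` and `|a'| > 1`. -/
def SameDirection (T T' : PSL(2, ℂ)) : Prop :=
  ∃ (g : PSL(2, ℂ)) (a a' : ℂˣ), 1 < ‖(a : ℂ)‖ ∧ 1 < ‖(a' : ℂ)‖ ∧
    g * T * g⁻¹ = diagPSL a ∧ g * T' * g⁻¹ = diagPSL a'

/-- A primitive loxodromic element `T₀` of `Γ`, that is, a loxodromic element with
`C(T₀) = ⟨T₀⟩ × ⟨E⟩`, where `C(T₀)` is the centralizer in `Γ` and `E` has finite order,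
together with `E` and the numbers `a = a(T₀)`, `ζ = ζ(T₀)`. The numbers are read off in one
common diagonalization of `T₀` and `E`; they are unique up to sign, and only `a²`, `ζ²` will
be used. (The product of `⟨T₀⟩` and `⟨E⟩` is direct because `T₀` has infinite order.) -/
structure PrimitiveDatum (Γ : Subgroup PSL(2, ℂ)) where
  /-- the primitive loxodromic element -/
  T₀ : Γ
  /-- a generator of the finite part of the centralizer -/
  E : Γ
  /-- the eigenvalue `a(T₀)` -/
  a : ℂˣ
  /-- the eigenvalue `ζ(T₀)` of `E` -/
  ζ : ℂˣ
  one_lt_norm : 1 < ‖(a : ℂ)‖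
  exists_conj : ∃ g : PSL(2, ℂ),
    g * (T₀ : PSL(2, ℂ)) * g⁻¹ = diagPSL a ∧ g * (E : PSL(2, ℂ)) * g⁻¹ = diagPSL ζ
  isOfFinOrder : IsOfFinOrder E
  centralizer_eq : Subgroup.centralizer {T₀} = Subgroup.zpowers T₀ ⊔ Subgroup.zpowers E

/-- The norm `N(T₀) = |a(T₀)|²`. -/
def PrimitiveDatum.N {Γ : Subgroup PSL(2, ℂ)} (D : PrimitiveDatum Γ) : ℝ :=
  ‖(D.a : ℂ)‖ ^ 2

/-- The `Γ`-conjugacy classes of `T` and `T'` have representatives with the same centralizer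
that translate in the same direction along their common axis. -/
def AxisEquiv {Γ : Subgroup PSL(2, ℂ)} (T T' : Γ) : Prop :=
  ∃ γ : Γ, Subgroup.centralizer {γ * T * γ⁻¹} = Subgroup.centralizer {T'} ∧
    SameDirection ((γ * T * γ⁻¹ : Γ) : PSL(2, ℂ)) (T' : PSL(2, ℂ))

/-- A maximal reduced system of (representatives of) `Γ`-conjugacy classes of primitive
loxodromic elements of `Γ`. -/
structure ReducedSystem (Γ : Subgroup PSL(2, ℂ)) where
  /-- the chosen representatives -/
  carrier : Set (PrimitiveDatum Γ)
  reduced : ∀ D ∈ carrier, ∀ D' ∈ carrier, AxisEquiv D.T₀ D'.T₀ → D = D'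
  maximal : ∀ D : PrimitiveDatum Γ, ∃ D' ∈ carrier, AxisEquiv D.T₀ D'.T₀

section JointEigenvalues

variable {V : Type*} [AddCommGroup V] [Module ℂ V]

/-- `p` lists the pairs of eigenvalues of `A` and `B` on a common eigenbasis. -/
def IsJointEigenvalues (A B : V →ₗ[ℂ] V) (p : Fin (Module.finrank ℂ V) → ℂ × ℂ) : Prop :=
  ∃ b : Module.Basis (Fin (Module.finrank ℂ V)) ℂ V,
    ∀ j, A (b j) = (p j).1 • b j ∧ B (b j) = (p j).2 • b j

open Classical in
/-- The pairs of eigenvalues, with multiplicity, of two simultaneously diagonalizable operators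
(such as two commuting unitary ones); they are unique up to order. -/
def jointEigenvalues (A B : V →ₗ[ℂ] V) : Fin (Module.finrank ℂ V) → ℂ × ℂ :=
  if h : ∃ p, IsJointEigenvalues A B p then h.choose else 0

end JointEigenvalues

section Zeta

variable {Γ : Subgroup PSL(2, ℂ)} {V : Type*} [AddCommGroup V] [Module ℂ V]

/-- The eigenvalue `𝔱ⱼ` of `χ(T₀)`. -/
def eigT (χ : Representation ℂ Γ V) (D : PrimitiveDatum Γ) (j : Fin (Module.finrank ℂ V)) : ℂ :=
  (jointEigenvalues (χ D.T₀) (χ D.E) j).1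

/-- The eigenvalue `𝔱'ⱼ` of `χ(E)`, on the same eigenvector as `𝔱ⱼ`. -/
def eigE (χ : Representation ℂ Γ V) (D : PrimitiveDatum Γ) (j : Fin (Module.finrank ℂ V)) : ℂ :=
  (jointEigenvalues (χ D.T₀) (χ D.E) j).2

/-- `c(T₀, j, l, k) = 𝔱'ⱼ ζ(T₀)^{2l} ζ(T₀)^{-2k}`. -/
def coeffC (χ : Representation ℂ Γ V) (D : PrimitiveDatum Γ) (j : Fin (Module.finrank ℂ V))
    (l k : ℕ) : ℂ :=
  eigE χ D j * (D.ζ : ℂ) ^ (2 * (l : ℤ)) * (D.ζ : ℂ) ^ (-2 * (k : ℤ))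

/-- `𝔱ⱼ a(T₀)^{-2k} conj(a(T₀)^{-2l}) N(T₀)^{-s-1}`. -/
def eulerTerm (χ : Representation ℂ Γ V) (s : ℂ) (D : PrimitiveDatum Γ)
    (j : Fin (Module.finrank ℂ V)) (l k : ℕ) : ℂ :=
  eigT χ D j * (D.a : ℂ) ^ (-2 * (k : ℤ)) * conj ((D.a : ℂ) ^ (-2 * (l : ℤ))) *
    (D.N : ℂ) ^ (-s - 1)

/-- The index set of the Euler product: all `(T₀, j, l, k)` with `c(T₀, j, l, k) = 1`. -/
def EulerIndex (R : ReducedSystem Γ) (χ : Representation ℂ Γ V) : Type :=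
  {p : R.carrier × Fin (Module.finrank ℂ V) × ℕ × ℕ //
    coeffC χ p.1 p.2.1 p.2.2.1 p.2.2.2 = 1}

/-- The term of the Euler product at an index. -/
def termAt (R : ReducedSystem Γ) (χ : Representation ℂ Γ V) (s : ℂ) (p : EulerIndex R χ) : ℂ :=
  eulerTerm χ s p.1.1 p.1.2.1 p.1.2.2.1 p.1.2.2.2

/-- The Euler product `∏ (1 - xₚ)` of `Z(s, Γ, χ)` converges absolutely: `∑ |xₚ| < ∞`. -/
def ZetaConverges (R : ReducedSystem Γ) (χ : Representation ℂ Γ V) (s : ℂ) : Prop :=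
  Summable fun p : EulerIndex R χ => ‖termAt R χ s p‖

/-- The Selberg zeta function `Z(s, Γ, χ)`, as an Euler product over `R`. -/
def selbergZeta (R : ReducedSystem Γ) (χ : Representation ℂ Γ V) (s : ℂ) : ℂ :=
  ∏' p : EulerIndex R χ, (1 - termAt R χ s p)

end Zeta

section Induced

variable {G : Type*} [Group G] {H K : Subgroup G} {V : Type*} [AddCommGroup V] [Module ℂ V]

open Classical in
/-- The extension of `χ` from `H` to `K` by zero. -/
def extendZero (χ : Representation ℂ H V) (γ : K) : V →ₗ[ℂ] V :=
  if h : (γ : G) ∈ H then χ ⟨γ, h⟩ else 0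

/-- `α` is a complete set of representatives of the right cosets `H γ` in `K`. -/
def IsRightTransversal (H : Subgroup G) {K : Subgroup G} {n : ℕ} (α : Fin n → K) : Prop :=
  ∀ γ : K, ∃! i, ((γ * (α i)⁻¹ : K) : G) ∈ H

theorem extendZero_mul (χ : Representation ℂ H V) {x y : K} (hx : (x : G) ∈ H) :
    extendZero χ (x * y) = extendZero χ x ∘ₗ extendZero χ y := by
  by_cases hy : (y : G) ∈ H
  · have hxy : ((x * y : K) : G) ∈ H := H.mul_mem hx hy
    rw [extendZero, dif_pos hxy, extendZero, dif_pos hx, extendZero, dif_pos hy]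
    exact χ.map_mul ⟨x, hx⟩ ⟨y, hy⟩
  · have hxy : ((x * y : K) : G) ∉ H := fun h => hy ((H.mul_mem_cancel_left hx).1 h)
    rw [extendZero, dif_neg hxy, extendZero, extendZero, dif_neg hy, LinearMap.comp_zero]

theorem extendZero_sum (χ : Representation ℂ H V) {n : ℕ} {α : Fin n → K}
    (hα : IsRightTransversal H α) (x y : K) :
    ∑ j, extendZero χ (x * (α j)⁻¹) ∘ₗ extendZero χ (α j * y) = extendZero χ (x * y) := by
  obtain ⟨i, hi, hu⟩ := hα x
  rw [Finset.sum_eq_single i]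
  · rw [← extendZero_mul χ hi]
    congr 1
    group
  · intro j _ hj
    have h : ((x * (α j)⁻¹ : K) : G) ∉ H := fun h => hj (hu j h)
    rw [extendZero, dif_neg h, LinearMap.zero_comp]
  · simp

theorem extendZero_diag (χ : Representation ℂ H V) {n : ℕ} {α : Fin n → K}
    (hα : IsRightTransversal H α) (i j : Fin n) :
    extendZero χ (α i * (α j)⁻¹) = if i = j then 1 else 0 := by
  have hi : ((α i * (α i)⁻¹ : K) : G) ∈ H := by simp
  split_ifs with h
  · subst h
    have : (⟨((α i * (α i)⁻¹ : K) : G), hi⟩ : H) = 1 := by ext; simp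
    rw [extendZero, dif_pos hi, this, map_one]
  · obtain ⟨k, _, hu⟩ := hα (α i)
    have hj : ((α i * (α j)⁻¹ : K) : G) ∉ H := fun h' => h ((hu i hi).trans (hu j h').symm)
    rw [extendZero, dif_neg hj]

/-- The induced representation `U^χ` of `K` in `Vⁿ`:
`(U^χ(γ) v)ᵢ = ∑ⱼ χ̄(αᵢ γ αⱼ⁻¹) vⱼ`, where `χ̄` is `χ` extended by zero. -/
def inducedRep (χ : Representation ℂ H V) {n : ℕ} (α : Fin n → K)
    (hα : IsRightTransversal H α) : Representation ℂ K (Fin n → V) where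
  toFun γ := LinearMap.pi fun i => ∑ j, extendZero χ (α i * γ * (α j)⁻¹) ∘ₗ LinearMap.proj j
  map_one' := by
    refine LinearMap.ext fun v => funext fun i => ?_
    simp only [LinearMap.pi_apply, LinearMap.sum_apply, LinearMap.comp_apply,
      LinearMap.proj_apply, mul_one, extendZero_diag χ hα]
    rw [Finset.sum_eq_single i]
    · simp
    · intro j _ hj
      simp [hj.symm]
    · simp
  map_mul' γ δ := by
    refine LinearMap.ext fun v => funext fun i => ?_
    simp only [LinearMap.pi_apply, LinearMap.sum_apply, LinearMap.comp_apply,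
      LinearMap.proj_apply, Module.End.mul_apply, map_sum]
    rw [Finset.sum_comm]
    refine Finset.sum_congr rfl fun k _ => ?_
    have h := congrArg (fun f : V →ₗ[ℂ] V => f (v k))
      (extendZero_sum χ hα (α i * γ) (δ * (α k)⁻¹))
    simp only [LinearMap.sum_apply, LinearMap.comp_apply] at h
    simpa only [mul_assoc] using h.symm

end Induced

/-- A representation on a complex inner product space is unitary. -/
def IsUnitary {G V : Type*} [Group G] [NormedAddCommGroup V] [InnerProductSpace ℂ V]
    (ρ : Representation ℂ G V) : Prop :=
  ∀ g x y, inner ℂ (ρ g x) (ρ g y) = inner ℂ x y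

/-- `ϑ` is a complete list, without repetition up to equivalence, of the irreducible unitary
representations of the finite group `G`. These are finite-dimensional, so that completeness may
be tested on the standard spaces `ℂᵈ`. -/
structure IsUnitaryDual {G : Type*} [Group G] {ι : Type*} {V : ι → Type*}
    [∀ i, NormedAddCommGroup (V i)] [∀ i, InnerProductSpace ℂ (V i)]
    (ϑ : ∀ i, Representation ℂ G (V i)) : Prop where
  unitary : ∀ i, IsUnitary (ϑ i)
  irreducible : ∀ i, (ϑ i).IsIrreducible
  inequivalent : ∀ i j, i ≠ j → IsEmpty ((ϑ i).Equiv (ϑ j))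
  complete : ∀ (d : ℕ) (ρ : Representation ℂ G (EuclideanSpace ℂ (Fin d))),
    IsUnitary ρ → ρ.IsIrreducible → ∃ i, Nonempty (ρ.Equiv (ϑ i))

end SelbergZeta

end

/-! The Euler products are regrouped over triples (T₀, l, k), and the identities are checked one
triple at a time. The factor at a triple depends only on the joint eigenvalues of the commuting pair
χ(T₀), χ(E).

Second equality: the trivial representation of Γ₁ induces the right regular representation of Q =
Γ₁\Γ (`exists_equiv_inducedRep_trivial`). This contains each ϑ exactly dim ϑ times
(`IsUnitaryDual.card_multiplicity`), so the local factors agree.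

First equality: let C be the centralizer of T₀ in Γ and A its image in Q. Restricted to A, the
regular representation contains each character ψ of A exactly [Q : A] times. Over T₀ lie equally
many members of the reduced system of Γ₁, because they correspond to the cosets of A in Q
(`bijective_fibre`). It remains to compare the product over all ψ with the factor of a single T₁
above T₀. The terms are values of a quasi-character φ of C: the term of ψ is (ψφ)(T₀), and it is
present when (ψφ)(E) = 1. If φ(E₁) = 1, such ψ correspond to the solutions x = (ψφ)(T₀) of x^e =
φ(T₁), where e is the degree of T₁ relative to T₀, and the product of the 1 - x is 1 - φ(T₁). If
φ(E₁) ≠ 1, no such ψ exists. This is `IsGeneratedBy.prod_twist`.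

Convergence: twisting moves the condition on (l, k) to another residue class. A shift of l or k
moves it back without decreasing the weights (`summable_twist`), so the products over Γ converge.
For Γ₁, each term is bounded by the sum of the terms of the ψ (`IsGeneratedBy.norm_le_sum_twist`).
-/

noncomputable section

namespace SelbergZeta

/-! ### Joint eigenvalues of commuting operators. -/

section JointEigenvalues

variable {V : Type*} [AddCommGroup V] [Module ℂ V] {A B : V →ₗ[ℂ] V}
  {κ κ' : Type*} [Fintype κ] [Fintype κ']

/-- The left side does not mention the basis, so the multiplicity of each eigenvalue pair is
intrinsic. This makes the chosen list `jointEigenvalues` usable. -/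
theorem finrank_inf_eigenspace (b : Module.Basis κ ℂ V) {p : κ → ℂ × ℂ}
    (hb : ∀ i, A (b i) = (p i).1 • b i ∧ B (b i) = (p i).2 • b i) (x : ℂ × ℂ) :
    Module.finrank ℂ ↥(Module.End.eigenspace A x.1 ⊓ Module.End.eigenspace B x.2) =
      Nat.card {i // p i = x} := by
  classical
  have key : Module.End.eigenspace A x.1 ⊓ Module.End.eigenspace B x.2 =
      Submodule.span ℂ (Set.range fun i : {i // p i = x} => b i) := by
    apply le_antisymm
    · rintro v ⟨hA, hB⟩
      rw [SetLike.mem_coe, Module.End.mem_eigenspace_iff] at hA hB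
      have hr : (Set.range fun i : {i // p i = x} => b i) = b '' {i | p i = x} := by
        ext; simp
      rw [hr, Module.Basis.mem_span_image]
      intro i hi
      have hv := b.sum_repr v
      have hAv : A v = ∑ i, (b.repr v i * (p i).1) • b i := by
        conv_lhs => rw [← hv]
        simp only [map_sum, map_smul, (hb _).1, mul_smul]
      have hBv : B v = ∑ i, (b.repr v i * (p i).2) • b i := by
        conv_lhs => rw [← hv]
        simp only [map_sum, map_smul, (hb _).2, mul_smul]
      have h1 := congrArg (fun w => b.repr w i) (hAv.symm.trans hA)
      have h2 := congrArg (fun w => b.repr w i) (hBv.symm.trans hB)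
      simp only [b.repr_sum_self, map_smul, Finsupp.smul_apply, smul_eq_mul] at h1 h2
      have hne : b.repr v i ≠ 0 := by simpa using hi
      rw [mul_comm] at h1 h2
      exact Prod.ext (mul_right_cancel₀ hne h1) (mul_right_cancel₀ hne h2)
    · rw [Submodule.span_le]
      rintro _ ⟨⟨i, rfl⟩, rfl⟩
      exact ⟨Module.End.mem_eigenspace_iff.2 (hb i).1, Module.End.mem_eigenspace_iff.2 (hb i).2⟩
  rw [key, Nat.card_eq_fintype_card]
  exact finrank_span_eq_card (b.linearIndependent.comp _ Subtype.val_injective)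

theorem exists_equiv_of_joint_eigenbases (b : Module.Basis κ ℂ V) {p : κ → ℂ × ℂ}
    (hb : ∀ i, A (b i) = (p i).1 • b i ∧ B (b i) = (p i).2 • b i)
    (b' : Module.Basis κ' ℂ V) {p' : κ' → ℂ × ℂ}
    (hb' : ∀ i, A (b' i) = (p' i).1 • b' i ∧ B (b' i) = (p' i).2 • b' i) :
    ∃ σ : κ ≃ κ', ∀ i, p' (σ i) = p i := by
  have h : ∀ x, Nonempty ({i // p i = x} ≃ {i // p' i = x}) := fun x =>
    Finite.card_eq.1 ((finrank_inf_eigenspace b hb x).symm.trans (finrank_inf_eigenspace b' hb' x))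
  let e := fun x => (h x).some
  refine ⟨(Equiv.sigmaFiberEquiv p).symm.trans
    ((Equiv.sigmaCongrRight e).trans (Equiv.sigmaFiberEquiv p')), fun i => ?_⟩
  exact (e (p i) ⟨i, rfl⟩).2

/-- The list `jointEigenvalues A B` may be read off on any common eigenbasis. -/
theorem exists_equiv_jointEigenvalues (b : Module.Basis κ ℂ V) {p : κ → ℂ × ℂ}
    (hb : ∀ i, A (b i) = (p i).1 • b i ∧ B (b i) = (p i).2 • b i) :
    ∃ σ : κ ≃ Fin (Module.finrank ℂ V), ∀ i, jointEigenvalues A B (σ i) = p i := by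
  have hex : ∃ p, IsJointEigenvalues A B p := by
    let σ : κ ≃ Fin (Module.finrank ℂ V) :=
      Fintype.equivFinOfCardEq (Module.finrank_eq_card_basis b).symm
    exact ⟨p ∘ σ.symm, b.reindex σ, fun j => by simpa using hb (σ.symm j)⟩
  obtain ⟨b', hb'⟩ := hex.choose_spec
  rw [jointEigenvalues, dif_pos hex]
  exact exists_equiv_of_joint_eigenbases b hb b' hb'

theorem prod_jointEigenvalues {M : Type*} [CommMonoid M] (F : ℂ × ℂ → M)
    (b : Module.Basis κ ℂ V) {p : κ → ℂ × ℂ}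
    (hb : ∀ i, A (b i) = (p i).1 • b i ∧ B (b i) = (p i).2 • b i) :
    ∏ j, F (jointEigenvalues A B j) = ∏ i, F (p i) := by
  obtain ⟨σ, hσ⟩ := exists_equiv_jointEigenvalues b hb
  rw [← σ.prod_comp]
  simp [hσ]

theorem norm_jointEigenvalues_fst_le {N : ℕ} (hN : N ≠ 0) (hA : A ^ N = 1)
    (j : Fin (Module.finrank ℂ V)) : ‖(jointEigenvalues A B j).1‖ ≤ 1 := by
  by_cases h : ∃ p, IsJointEigenvalues A B p
  · rw [jointEigenvalues, dif_pos h]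
    obtain ⟨b, hb⟩ := h.choose_spec
    set t := (h.choose j).1
    have hpow : ∀ k : ℕ, (A ^ k) (b j) = t ^ k • b j := by
      intro k
      induction k with
      | zero => simp
      | succ k ih => rw [pow_succ', Module.End.mul_apply, ih, map_smul, (hb j).1, smul_smul,
          pow_succ]
    have h1 : t ^ N • b j = (1 : ℂ) • b j := by rw [← hpow N, hA]; simp
    have h2 : t ^ N = 1 := smul_left_injective ℂ (b.ne_zero j) h1
    have h3 : ‖t‖ ^ N = 1 := by rw [← norm_pow, h2, norm_one]
    exact ((pow_eq_one_iff_of_nonneg (norm_nonneg _) hN).1 h3).le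
  -- Without a common eigenbasis the list takes its default value 0, so the bound holds in this case
  -- too.
  · rw [jointEigenvalues, dif_neg h]
    simp

/-- Two commuting operators of finite order have a common eigenbasis. -/
theorem exists_joint_eigenbasis [FiniteDimensional ℂ V] {N : ℕ} (hN : N ≠ 0)
    (hA : A ^ N = 1) (hB : B ^ N = 1) (hAB : Commute A B) :
    ∃ (p : Fin (Module.finrank ℂ V) → ℂ × ℂ)
      (b : Module.Basis (Fin (Module.finrank ℂ V)) ℂ V),
      ∀ i, A (b i) = (p i).1 • b i ∧ B (b i) = (p i).2 • b i := by
  classical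
  -- The polynomial X^N - 1 is separable in characteristic zero, so both operators are semisimple
  -- and their generalized eigenspaces are eigenspaces.
  have hss : ∀ T : Module.End ℂ V, T ^ N = 1 → T.IsSemisimple := by
    intro T hT
    refine Module.End.isSemisimple_of_squarefree_aeval_eq_zero
      (p := Polynomial.X ^ N - Polynomial.C (1 : ℂ)) ?_ (by simp [hT])
    exact (Polynomial.separable_X_pow_sub_C 1 (by exact_mod_cast hN) one_ne_zero).squarefree
  let T : Bool → Module.End ℂ V := fun i => cond i A B
  have hT : ∀ i, (T i).IsFinitelySemisimple := by
    rintro (_ | _)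
    · exact Module.End.isFinitelySemisimple_iff_isSemisimple.2 (hss B hB)
    · exact Module.End.isFinitelySemisimple_iff_isSemisimple.2 (hss A hA)
  have hcomm : ∀ i j, Commute (T i) (T j) := by
    rintro (_ | _) (_ | _)
    exacts [Commute.refl _, hAB.symm, hAB, Commute.refl _]
  have hmaps : ∀ i j φ, Set.MapsTo (T i) ((T j).maxGenEigenspace φ) ((T j).maxGenEigenspace φ) :=
    fun i j φ => Module.End.mapsTo_maxGenEigenspace_of_comm (hcomm j i) φ
  have hind := Module.End.independent_iInf_maxGenEigenspace_of_forall_mapsTo T hmaps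
  have htop := Module.End.iSup_iInf_maxGenEigenspace_eq_top_of_forall_mapsTo T hmaps
    (fun i => Module.End.iSup_maxGenEigenspace_eq_top (T i))
  have hint : DirectSum.IsInternal
      (fun χ : Bool → ℂ => ⨅ i, (T i).maxGenEigenspace (χ i)) :=
    DirectSum.isInternal_submodule_of_iSupIndep_of_iSup_eq_top hind htop
  let b := hint.collectedBasis fun χ => Module.finBasis ℂ
    ↥(⨅ i, (T i).maxGenEigenspace (χ i))
  have : Fintype (Σ χ : Bool → ℂ, Fin (Module.finrank ℂ ↥(⨅ i, (T i).maxGenEigenspace (χ i)))) :=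
    FiniteDimensional.fintypeBasisIndex b
  let σ := Fintype.equivFinOfCardEq (Module.finrank_eq_card_basis b).symm
  refine ⟨fun i => ((σ.symm i).1 true, (σ.symm i).1 false), b.reindex σ, fun i => ?_⟩
  have hmem := hint.collectedBasis_mem (fun χ => Module.finBasis ℂ
    ↥(⨅ i, (T i).maxGenEigenspace (χ i))) (σ.symm i)
  rw [Submodule.mem_iInf] at hmem
  have h1 := hmem true
  have h2 := hmem false
  rw [(hT _).maxGenEigenspace_eq_eigenspace, Module.End.mem_eigenspace_iff] at h1 h2
  rw [Module.Basis.reindex_apply]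
  exact ⟨h1, h2⟩

theorem exists_equiv_jointEigenvalues_congr {W : Type*} [AddCommGroup W] [Module ℂ W]
    [FiniteDimensional ℂ W] {A' B' : W →ₗ[ℂ] W} {N : ℕ} (hN : N ≠ 0)
    (hA' : A' ^ N = 1) (hB' : B' ^ N = 1) (hAB' : Commute A' B') (e : V ≃ₗ[ℂ] W)
    (hA : ∀ v, e (A v) = A' (e v)) (hB : ∀ v, e (B v) = B' (e v)) :
    ∃ σ : Fin (Module.finrank ℂ V) ≃ Fin (Module.finrank ℂ W),
      ∀ j, jointEigenvalues A' B' (σ j) = jointEigenvalues A B j := by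
  obtain ⟨p, b, hb⟩ := exists_joint_eigenbasis hN hA' hB' hAB'
  obtain ⟨σ, hσ⟩ := exists_equiv_jointEigenvalues b hb
  have hb' : ∀ i, A (b.map e.symm i) = (p i).1 • b.map e.symm i ∧
      B (b.map e.symm i) = (p i).2 • b.map e.symm i := fun i => by
    constructor <;> apply e.injective <;> simp [hA, hB, hb i]
  obtain ⟨τ, hτ⟩ := exists_equiv_jointEigenvalues (b.map e.symm) hb'
  refine ⟨τ.symm.trans σ, fun j => ?_⟩
  rw [Equiv.trans_apply, hσ, ← hτ, Equiv.apply_symm_apply]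

end JointEigenvalues

/-! ### Complete reducibility over the unitary dual. -/

section UnitaryDual

variable {G : Type*} [Group G] {ι : Type*} {V : ι → Type*}
  [∀ i, NormedAddCommGroup (V i)] [∀ i, InnerProductSpace ℂ (V i)]
  {ϑ : ∀ i, Representation ℂ G (V i)}

/-- The orthogonal complement of an invariant subspace of a unitary representation. -/
def orthogonalSubrep {W : Type*} [NormedAddCommGroup W] [InnerProductSpace ℂ W]
    {ρ : Representation ℂ G W} (hρ : IsUnitary ρ) (S : Subrepresentation ρ) :
    Subrepresentation ρ where
  toSubmodule := S.toSubmoduleᗮ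
  apply_mem_toSubmodule g v hv := by
    rw [Submodule.mem_orthogonal] at hv ⊢
    intro u hu
    have h := hρ g (ρ g⁻¹ u) v
    rw [Representation.self_inv_apply] at h
    rw [h]
    exact hv _ (S.apply_mem_toSubmodule _ hu)

theorem IsUnitary.toRepresentation {W : Type*} [NormedAddCommGroup W] [InnerProductSpace ℂ W]
    {ρ : Representation ℂ G W} (hρ : IsUnitary ρ) (S : Subrepresentation ρ) :
    IsUnitary S.toRepresentation := fun g x y => hρ g x y

/-- An irreducible unitary representation is equivalent to a member of the unitary dual. -/
theorem IsUnitaryDual.exists_equiv (hϑ : IsUnitaryDual ϑ) {W : Type*} [NormedAddCommGroup W]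
    [InnerProductSpace ℂ W] [FiniteDimensional ℂ W] (ρ : Representation ℂ G W)
    (hρ : IsUnitary ρ) (hirr : ρ.IsIrreducible) : ∃ i, Nonempty (ρ.Equiv (ϑ i)) := by
  -- Completeness of the dual is formulated on the standard spaces, so ρ is transported there by an
  -- isometry, which preserves unitarity and irreducibility.
  let b := (stdOrthonormalBasis ℂ W).repr
  let ρ' : Representation ℂ G (EuclideanSpace ℂ (Fin (Module.finrank ℂ W))) :=
    { toFun := fun g => b.toLinearEquiv.toLinearMap ∘ₗ ρ g ∘ₗ b.symm.toLinearEquiv.toLinearMap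
      map_one' := by ext; simp
      map_mul' := fun g h => by ext; simp }
  have happ : ∀ g x, ρ' g x = b (ρ g (b.symm x)) := fun _ _ => rfl
  let e : ρ.Equiv ρ' := Representation.Equiv.mk b.toLinearEquiv fun g => by
    ext1 v
    simp [happ]
  have hu : IsUnitary ρ' := fun g x y => by
    rw [happ, happ, b.inner_map_map, hρ, LinearIsometryEquiv.inner_map_map]
  have hi : ρ'.IsIrreducible := by
    rw [Representation.irreducible_iff_isSimpleModule_asModule] at hirr ⊢
    exact IsSimpleModule.congr (LinearEquiv.ofBijective
      (Representation.IntertwiningMap.equivLinearMapAsModule ρ' ρ e.symm.toIntertwiningMap)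
      e.symm.toLinearEquiv.bijective)
  obtain ⟨i, ⟨f⟩⟩ := hϑ.complete _ ρ' hu hi
  exact ⟨i, ⟨e.trans f⟩⟩

/-- Induction on the dimension: a reducible unitary representation splits as a proper invariant
subspace and its orthogonal complement, both of smaller dimension. -/
theorem IsUnitaryDual.exists_decomposition (hϑ : IsUnitaryDual ϑ) {W : Type*} [NormedAddCommGroup W]
    [InnerProductSpace ℂ W] [FiniteDimensional ℂ W] (ρ : Representation ℂ G W)
    (hρ : IsUnitary ρ) :
    ∃ (κ : Type) (_ : Fintype κ) (c : κ → ι) (e : W ≃ₗ[ℂ] (∀ j, V (c j))),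
      ∀ g w j, e (ρ g w) j = ϑ (c j) g (e w j) := by
  induction hd : Module.finrank ℂ W using Nat.strong_induction_on generalizing W with
  | _ d ih =>
  by_cases hW : Subsingleton W
  · refine ⟨Empty, inferInstance, Empty.elim, 0, fun g w j => j.elim⟩
  by_cases hirr : ρ.IsIrreducible
  · obtain ⟨i, ⟨f⟩⟩ := hϑ.exists_equiv ρ hρ hirr
    refine ⟨Unit, inferInstance, fun _ => i,
      f.toLinearEquiv.trans (LinearEquiv.funUnique Unit ℂ (V i)).symm, fun g w j => ?_⟩
    exact f.toIntertwiningMap.isIntertwining _ _ g w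
  obtain ⟨S, hbot, htop⟩ : ∃ S : Subrepresentation ρ, S.toSubmodule ≠ ⊥ ∧ S.toSubmodule ≠ ⊤ := by
    by_contra! hno
    apply hirr
    have hne : (⊥ : Subrepresentation ρ) ≠ ⊤ := by
      intro h
      have h' : (⊥ : Submodule ℂ W) = ⊤ := congrArg Subrepresentation.toSubmodule h
      exact hW ((Submodule.subsingleton_iff ℂ).1 (subsingleton_of_bot_eq_top h'))
    have : Nontrivial (Subrepresentation ρ) := ⟨_, _, hne⟩
    refine ⟨fun S => ?_⟩
    by_cases h : S.toSubmodule = ⊥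
    · exact Or.inl (Subrepresentation.toSubmodule_injective h)
    · exact Or.inr (Subrepresentation.toSubmodule_injective (hno S h))
  let S' := orthogonalSubrep hρ S
  have hlt : Module.finrank ℂ S.toSubmodule < d := hd ▸ Submodule.finrank_lt htop
  have hlt' : Module.finrank ℂ S'.toSubmodule < d := by
    refine hd ▸ Submodule.finrank_lt fun h => hbot ?_
    exact (Submodule.orthogonal_eq_top_iff _).1 h
  obtain ⟨κ₁, _, c₁, e₁, he₁⟩ := ih _ hlt _ (hρ.toRepresentation S) rfl
  obtain ⟨κ₂, _, c₂, e₂, he₂⟩ := ih _ hlt' _ (hρ.toRepresentation S') rfl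
  let u := Submodule.prodEquivOfIsCompl S.toSubmodule S'.toSubmodule
    (Submodule.isCompl_orthogonal _)
  have huapp : ∀ x, u x = x.1 + x.2 := Submodule.coe_prodEquivOfIsCompl' _ _ _
  have hu : ∀ g w, u.symm (ρ g w) =
      (S.toRepresentation g (u.symm w).1, S'.toRepresentation g (u.symm w).2) := by
    intro g w
    rw [LinearEquiv.symm_apply_eq]
    conv_lhs => rw [← u.apply_symm_apply w]
    rw [huapp, huapp, map_add]
    rfl
  refine ⟨κ₁ ⊕ κ₂, inferInstance, Sum.elim c₁ c₂,
    u.symm.trans ((e₁.prodCongr e₂).trans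
      (LinearEquiv.sumPiEquivProdPi ℂ κ₁ κ₂ (fun j => V (Sum.elim c₁ c₂ j))).symm), ?_⟩
  rintro g w (j | j)
  · simpa [hu] using! he₁ g (u.symm w).1 j
  · simpa [hu] using! he₂ g (u.symm w).2 j

end UnitaryDual

/-! ### The regular representation of a finite group. -/

section Regular

variable {G : Type*} [Group G]

/-- The right regular representation on functions, `(ρ(g) f)(x) = f (x g)`. -/
def rightRegular (G : Type*) [Group G] : Representation ℂ G (G → ℂ) where
  toFun g := LinearMap.funLeft ℂ ℂ (· * g)
  map_one' := by ext; simp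
  map_mul' g h := by ext; simp [mul_assoc, LinearMap.funLeft]

@[simp]
theorem rightRegular_apply (g : G) (f : G → ℂ) (x : G) : rightRegular G g f x = f (x * g) := rfl

variable {W : Type*} [AddCommGroup W] [Module ℂ W]

/-- Intertwining maps out of the regular representation are determined by the image of the
delta function at the identity, which is arbitrary. -/
def rightRegularHomEquiv [Fintype G] [DecidableEq G] (ρ : Representation ℂ G W) :
    (rightRegular G).IntertwiningMap ρ ≃ₗ[ℂ] W where
  toFun φ := φ (Pi.single 1 1)
  map_add' _ _ := rfl
  map_smul' _ _ := rfl
  invFun w :=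
    { toLinearMap := ∑ x, (LinearMap.proj x).smulRight (ρ x⁻¹ w)
      isIntertwining' := fun g => by
        refine LinearMap.ext fun f => ?_
        rw [LinearMap.comp_apply, LinearMap.comp_apply, LinearMap.sum_apply, LinearMap.sum_apply,
          ← Equiv.sum_comp (Equiv.mulRight g⁻¹), map_sum]
        refine Finset.sum_congr rfl fun x _ => ?_
        simp }
  left_inv φ := by
    apply Representation.IntertwiningMap.ext
    refine LinearMap.pi_ext' fun x => LinearMap.ext_ring ?_
    have h : (Pi.single x 1 : G → ℂ) = rightRegular G x⁻¹ (Pi.single 1 1) := by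
      ext y
      simp [Pi.single_apply, mul_inv_eq_one]
    simp only [LinearMap.comp_apply, LinearMap.sum_apply, LinearMap.smulRight_apply,
      LinearMap.proj_apply, LinearMap.single_apply]
    rw [Finset.sum_eq_single x (fun y _ hy => by simp [hy]) (by simp), Pi.single_eq_same, one_smul,
      Representation.IntertwiningMap.toLinearMap_apply, h,
      Representation.IntertwiningMap.isIntertwining]
  right_inv w := by
    change (∑ x, (LinearMap.proj x).smulRight (ρ x⁻¹ w)) (Pi.single 1 1) = w
    rw [LinearMap.sum_apply, Finset.sum_eq_single 1 (fun y _ hy => by simp [hy]) (by simp)]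
    simp

section Decomposition

variable {ι : Type*} {V : ι → Type*}
  [∀ i, NormedAddCommGroup (V i)] [∀ i, InnerProductSpace ℂ (V i)]
  {ϑ : ∀ i, Representation ℂ G (V i)} {κ : Type*} [Fintype κ] {c : κ → ι}

/-- Intertwining maps out of a direct sum. -/
def homPiEquiv [DecidableEq κ] {W' : Type*} [AddCommGroup W'] [Module ℂ W']
    {ρ : Representation ℂ G W} (σ : Representation ℂ G W') (e : W ≃ₗ[ℂ] (∀ j, V (c j)))
    (he : ∀ g w j, e (ρ g w) j = ϑ (c j) g (e w j)) :
    ρ.IntertwiningMap σ ≃ₗ[ℂ] (∀ j, (ϑ (c j)).IntertwiningMap σ) where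
  toFun φ j :=
    { toLinearMap := φ.toLinearMap ∘ₗ e.symm.toLinearMap ∘ₗ LinearMap.single ℂ (fun j => V (c j)) j
      isIntertwining' := fun g => by
        ext v
        have h : e.symm (Pi.single j (ϑ (c j) g v)) = ρ g (e.symm (Pi.single j v)) := by
          rw [LinearEquiv.symm_apply_eq]
          ext k
          rw [he, LinearEquiv.apply_symm_apply]
          by_cases hk : k = j
          · subst hk
            simp
          · simp [hk]
        simp [h, φ.isIntertwining] }
  map_add' _ _ := rfl
  map_smul' _ _ := rfl
  invFun f :=
    { toLinearMap := ∑ j, (f j).toLinearMap ∘ₗ LinearMap.proj j ∘ₗ e.toLinearMap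
      isIntertwining' := fun g => by
        ext w
        simp [he, (f _).isIntertwining] }
  left_inv φ := by
    apply Representation.IntertwiningMap.ext
    ext w
    have h : w = ∑ j, e.symm (Pi.single j (e w j)) := by
      rw [← map_sum, Finset.univ_sum_single, e.symm_apply_apply]
    conv_rhs => rw [h]
    simp
  right_inv f := by
    funext j
    apply Representation.IntertwiningMap.ext
    ext v
    simp only [LinearMap.comp_apply, LinearMap.sum_apply, LinearEquiv.coe_coe,
      LinearMap.single_apply, LinearEquiv.apply_symm_apply, LinearMap.proj_apply]
    rw [Finset.sum_eq_single j (fun k _ hk => by simp [hk]) (by simp), Pi.single_eq_same]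

/-- An irreducible representation occurs in the regular representation as often as its
dimension says. -/
theorem IsUnitaryDual.card_multiplicity [∀ i, FiniteDimensional ℂ (V i)] [Finite G]
    (hϑ : IsUnitaryDual ϑ) (e : (G → ℂ) ≃ₗ[ℂ] (∀ j, V (c j)))
    (he : ∀ g w j, e (rightRegular G g w) j = ϑ (c j) g (e w j)) (i : ι) :
    Nat.card {j // c j = i} = Module.finrank ℂ (V i) := by
  classical
  have := Fintype.ofFinite G
  have hirr := hϑ.irreducible
  -- The space of intertwining maps from the regular representation to `ϑ i` is computed twice. It
  -- is `V i` by evaluation at the delta function, and by Schur's lemma each summand of type i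
  -- contributes one dimension and every other summand none.
  have hfin : ∀ j, Module.finrank ℂ ((ϑ (c j)).IntertwiningMap (ϑ i)) =
      if c j = i then 1 else 0 := by
    intro j
    split_ifs with h
    · subst h
      exact Representation.IsIrreducible.finrank_intertwiningMap_self (ϑ (c j))
    · have := hϑ.inequivalent _ _ h
      exact Module.finrank_zero_of_subsingleton
  rw [← (rightRegularHomEquiv (ϑ i)).finrank_eq, (homPiEquiv (ϑ i) e he).finrank_eq,
    Module.finrank_pi_fintype, Finset.sum_congr rfl fun j _ => hfin j, Finset.sum_boole,
    Nat.card_eq_fintype_card, Fintype.card_subtype, Nat.cast_id]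

theorem IsUnitaryDual.exists_decomposition_rightRegular [Finite G]
    (hϑ : IsUnitaryDual ϑ) :
    ∃ (κ : Type) (_ : Fintype κ) (c : κ → ι) (e : (G → ℂ) ≃ₗ[ℂ] (∀ j, V (c j))),
      ∀ g w j, e (rightRegular G g w) j = ϑ (c j) g (e w j) := by
  have := Fintype.ofFinite G
  let u := (WithLp.linearEquiv 2 ℂ (G → ℂ))
  let ρ : Representation ℂ G (EuclideanSpace ℂ G) :=
    { toFun := fun g => u.symm.toLinearMap ∘ₗ rightRegular G g ∘ₗ u.toLinearMap
      map_one' := by ext; simp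
      map_mul' := fun g h => by ext; simp }
  have happ : ∀ g x, ρ g x = u.symm (rightRegular G g (u x)) := fun _ _ => rfl
  have hρ : IsUnitary ρ := by
    intro g x y
    rw [PiLp.inner_apply, PiLp.inner_apply]
    exact Equiv.sum_comp (Equiv.mulRight g) fun z => inner ℂ (x z) (y z)
  obtain ⟨κ, hκ, c, e, he⟩ := hϑ.exists_decomposition ρ hρ
  refine ⟨κ, hκ, c, u.symm.trans e, fun g w j => ?_⟩
  have := he g (u.symm w) j
  rwa [happ, LinearEquiv.apply_symm_apply] at this

/-- Every irreducible has positive dimension, hence occurs in the regular representation, which has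
finitely many summands. -/
theorem IsUnitaryDual.finite [∀ i, FiniteDimensional ℂ (V i)] [Finite G]
    (hϑ : IsUnitaryDual ϑ) : Finite ι := by
  obtain ⟨κ, hκ, c, e, he⟩ := hϑ.exists_decomposition_rightRegular
  refine Finite.of_surjective c fun i => ?_
  have hpos : 0 < Module.finrank ℂ (V i) := by
    have : Nontrivial (V i) := by
      by_contra hV
      rw [not_nontrivial_iff_subsingleton] at hV
      have := hϑ.irreducible i
      refine bot_ne_top (α := Subrepresentation (ϑ i)) ?_
      exact Subrepresentation.toSubmodule_injective (Subsingleton.elim _ _)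
    exact Module.finrank_pos
  rw [← hϑ.card_multiplicity e he i, Nat.card_pos_iff] at hpos
  obtain ⟨⟨j, hj⟩⟩ := hpos.1
  exact ⟨j, hj⟩

/-- The joint eigenvalues of two commuting elements in the regular representation, in terms of
those in the irreducible ones. -/
theorem IsUnitaryDual.prod_jointEigenvalues_rightRegular [Fintype ι]
    [∀ i, FiniteDimensional ℂ (V i)] [Finite G] (hϑ : IsUnitaryDual ϑ)
    {g h : G} (hgh : Commute g h) {M : Type*} [CommMonoid M] (F : ℂ × ℂ → M) :
    ∏ j, F (jointEigenvalues (rightRegular G g) (rightRegular G h) j) =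
      ∏ i, (∏ j, F (jointEigenvalues (ϑ i g) (ϑ i h) j)) ^ Module.finrank ℂ (V i) := by
  classical
  obtain ⟨κ, hκ, c, e, he⟩ := hϑ.exists_decomposition_rightRegular
  have hN : Nat.card G ≠ 0 := Nat.card_pos.ne'
  choose p b hb using fun i => exists_joint_eigenbasis hN
    (by rw [← map_pow, pow_card_eq_one', map_one] : ϑ i g ^ Nat.card G = 1)
    (by rw [← map_pow, pow_card_eq_one', map_one] : ϑ i h ^ Nat.card G = 1)
    (hgh.map (ϑ i))
  let B : Module.Basis (Σ j, Fin (Module.finrank ℂ (V (c j)))) ℂ (G → ℂ) :=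
    (Pi.basis fun j => b (c j)).map e.symm
  have hB : ∀ x, rightRegular G g (B x) = (p (c x.1) x.2).1 • B x ∧
      rightRegular G h (B x) = (p (c x.1) x.2).2 • B x := by
    rintro ⟨j, k⟩
    have heB : e (B ⟨j, k⟩) = Pi.single j (b (c j) k) := by
      simp [B]
    constructor <;> apply e.injective <;> ext1 j' <;> rw [he, map_smul, heB, Pi.smul_apply] <;>
      by_cases hj : j' = j
    · subst hj
      simpa using (hb (c j') k).1
    · simp [hj]
    · subst hj
      simpa using (hb (c j') k).2
    · simp [hj]
  rw [prod_jointEigenvalues F B hB, Fintype.prod_sigma]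
  have h1 : ∀ i, ∏ j, F (jointEigenvalues (ϑ i g) (ϑ i h) j) = ∏ k, F (p i k) := fun i =>
    prod_jointEigenvalues F (b i) (hb i)
  simp only [h1]
  rw [← Finset.prod_fiberwise' Finset.univ c fun i => ∏ k, F (p i k)]
  refine Finset.prod_congr rfl fun i _ => ?_
  have hcard := hϑ.card_multiplicity e he i
  rw [Nat.card_eq_fintype_card, Fintype.card_subtype] at hcard
  rw [Finset.prod_const, hcard]

end Decomposition

/-! ### Restriction of the regular representation to an abelian subgroup. -/

section AbelianSubgroup

variable {A : Type*} [CommGroup A]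

/-- Coordinates on G in which right translation by `f a` moves only the second one: functions on G
become one copy of the functions on A per coset, and the characters of A diagonalize each copy. -/
theorem bijective_out_mul {f : A →* G} (hf : Function.Injective f) :
    Function.Bijective fun x : (G ⧸ f.range) × A => x.1.out * f x.2 := by
  constructor
  · rintro ⟨q, a⟩ ⟨q', a'⟩ h
    simp only at h
    have hq : ∀ (q : G ⧸ f.range) a, ((q.out * f a : G) : G ⧸ f.range) = q := fun q a => by
      rw [QuotientGroup.mk_mul_of_mem _ (MonoidHom.mem_range.2 ⟨a, rfl⟩), QuotientGroup.out_eq']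
    have hqq : q = q' := by rw [← hq q a, ← hq q' a', h]
    subst hqq
    rw [hf (mul_left_cancel h)]
  · intro x
    obtain ⟨⟨_, a, rfl⟩, ha⟩ := QuotientGroup.mk_out_eq_mul f.range x
    exact ⟨(x, a⁻¹), by simp [ha]⟩

/-- On restriction to an abelian subgroup every character of it occurs in the regular
representation, with multiplicity the index. -/
theorem exists_eigenbasis_rightRegular [Finite A] [Finite G] {f : A →* G} (hf : Function.Injective f) :
    ∃ b : Module.Basis (Σ _ : G ⧸ f.range, AddChar (Additive A) ℂ) ℂ (G → ℂ),
      ∀ x a, rightRegular G (f a) (b x) = x.2 (Additive.ofMul a) • b x := by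
  classical
  have := Fintype.ofFinite (G ⧸ f.range)
  let σ : (G ⧸ f.range) × Additive A ≃ G := Equiv.ofBijective _ (bijective_out_mul hf)
  have hσ : ∀ q a a', σ (q, a) * f a' = σ (q, a + Additive.ofMul a') := fun q a a' => by
    change q.out * f (Additive.toMul a) * f a' = q.out * f (Additive.toMul a * a')
    rw [map_mul, mul_assoc]
  let e : (G → ℂ) ≃ₗ[ℂ] (G ⧸ f.range → Additive A → ℂ) :=
    (LinearEquiv.funCongrLeft ℂ ℂ σ).trans (LinearEquiv.curry ℂ ℂ _ _)
  have he : ∀ v q a, e v q a = v (σ (q, a)) := fun _ _ _ => rfl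
  let b := (Pi.basis fun _ : G ⧸ f.range => AddChar.complexBasis (Additive A)).map e.symm
  refine ⟨b, ?_⟩
  rintro ⟨q, ψ⟩ a
  have hb : e (b ⟨q, ψ⟩) = Pi.single q (ψ : Additive A → ℂ) := by simp [b]
  apply e.injective
  funext q' a'
  rw [he, rightRegular_apply, hσ, ← he (b ⟨q, ψ⟩), map_smul, hb, Pi.smul_apply, Pi.smul_apply]
  by_cases h : q' = q
  · subst h
    simp [AddChar.map_add_eq_mul, mul_comm]
  · simp [h]

theorem prod_jointEigenvalues_rightRegular [Finite A] [Finite G] {f : A →* G}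
    (hf : Function.Injective f) (a a' : A) {M : Type*} [CommMonoid M] (F : ℂ × ℂ → M) :
    ∏ j, F (jointEigenvalues (rightRegular G (f a)) (rightRegular G (f a')) j) =
      (∏ ψ : AddChar (Additive A) ℂ, F (ψ (Additive.ofMul a), ψ (Additive.ofMul a'))) ^
        f.range.index := by
  have := Fintype.ofFinite (G ⧸ f.range)
  obtain ⟨b, hb⟩ := exists_eigenbasis_rightRegular hf
  rw [prod_jointEigenvalues F b (p := fun x => (x.2 (Additive.ofMul a), x.2 (Additive.ofMul a')))
    (fun x => ⟨hb x a, hb x a'⟩), Fintype.prod_sigma]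
  simp only
  rw [Finset.prod_const, Finset.card_univ,
    Subgroup.index, Nat.card_eq_fintype_card]

theorem sum_jointEigenvalues_rightRegular [Finite A] [Finite G] {f : A →* G}
    (hf : Function.Injective f) (a a' : A) {M : Type*} [AddCommMonoid M] (F : ℂ × ℂ → M) :
    ∑ j, F (jointEigenvalues (rightRegular G (f a)) (rightRegular G (f a')) j) =
      f.range.index •
        ∑ ψ : AddChar (Additive A) ℂ, F (ψ (Additive.ofMul a), ψ (Additive.ofMul a')) :=
  prod_jointEigenvalues_rightRegular hf a a' (M := Multiplicative M) F

end AbelianSubgroup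

end Regular

/-! ### Inducing the trivial representation gives the regular one. -/

section InducedTrivial

variable {G : Type*} [Group G] {H K : Subgroup G} [(H.subgroupOf K).Normal] {n : ℕ}
  {α : Fin n → K}

/-- The transversal is for right cosets and the quotient is formed from left cosets; normality
identifies the two. -/
theorem bijective_mk_transversal (hα : IsRightTransversal H α) :
    Function.Bijective fun i => (α i : K ⧸ H.subgroupOf K) := by
  have key : ∀ (γ : K) i, (α i : K ⧸ H.subgroupOf K) = γ ↔ ((γ * (α i)⁻¹ : K) : G) ∈ H := by
    intro γ i
    rw [eq_comm, ← div_eq_one, div_eq_mul_inv, ← QuotientGroup.mk_inv, ← QuotientGroup.mk_mul,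
      QuotientGroup.eq_one_iff, Subgroup.mem_subgroupOf]
  constructor
  · intro i j hij
    obtain ⟨k, _, hk⟩ := hα (α j)
    rw [hk i ((key _ _).1 hij), hk j ((key _ _).1 rfl)]
  · intro x
    obtain ⟨γ, rfl⟩ := QuotientGroup.mk_surjective x
    obtain ⟨i, hi, _⟩ := hα γ
    exact ⟨i, (key _ _).2 hi⟩

/-- The representation induced from the trivial one is the regular representation of the
quotient. -/
theorem exists_equiv_inducedRep_trivial (hα : IsRightTransversal H α) :
    ∃ e : (Fin n → ℂ) ≃ₗ[ℂ] (K ⧸ H.subgroupOf K → ℂ), ∀ γ v,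
      e (inducedRep (Representation.trivial ℂ H ℂ) α hα γ v) =
        rightRegular (K ⧸ H.subgroupOf K) γ (e v) := by
  let σ := Equiv.ofBijective _ (bijective_mk_transversal hα)
  have hσ : ∀ i, σ i = (α i : K ⧸ H.subgroupOf K) := fun _ => rfl
  let e := LinearEquiv.funCongrLeft ℂ ℂ σ.symm
  refine ⟨e, fun γ v => ?_⟩
  funext x
  obtain ⟨i, rfl⟩ := σ.surjective x
  -- In row i only this column j is nonzero: the matrix of γ is the permutation matrix of right
  -- translation on the quotient.
  obtain ⟨j, hj, hu⟩ := hα (α i * γ)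
  have h1 : σ i * γ = σ j := by
    rw [hσ, hσ, ← QuotientGroup.mk_mul, ← div_eq_one, div_eq_mul_inv, ← QuotientGroup.mk_inv,
      ← QuotientGroup.mk_mul, QuotientGroup.eq_one_iff, Subgroup.mem_subgroupOf]
    exact hj
  have h2 : ∀ w k, e w (σ k) = w k := fun w k => by
    simp [e, LinearEquiv.funCongrLeft]
  rw [rightRegular_apply, h1, h2, h2]
  simp only [inducedRep, MonoidHom.coe_mk, OneHom.coe_mk, LinearMap.pi_apply, LinearMap.sum_apply,
    LinearMap.comp_apply, LinearMap.proj_apply]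
  rw [Finset.sum_eq_single j]
  · rw [extendZero, dif_pos hj]
    rfl
  · intro k _ hk
    rw [extendZero, dif_neg fun h => hk (hu k h), LinearMap.zero_apply]
  · simp

end InducedTrivial

/-! ### Grouping the Euler product by T₀, l and k. -/

section EulerProduct

variable {Γ : Subgroup PSL(2, ℂ)} {V : Type*} [AddCommGroup V] [Module ℂ V]

open Classical in
/-- The factors of the Euler product with given `T₀`, `l` and `k`. -/
def localProd (χ : Representation ℂ Γ V) (s : ℂ) (D : PrimitiveDatum Γ) (l k : ℕ) : ℂ :=
  ∏ j, if coeffC χ D j l k = 1 then 1 - eulerTerm χ s D j l k else 1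

open Classical in
/-- The sum of the absolute values of the terms with given `T₀`, `l` and `k`. -/
def localSum (χ : Representation ℂ Γ V) (s : ℂ) (D : PrimitiveDatum Γ) (l k : ℕ) : ℝ :=
  ∑ j, if coeffC χ D j l k = 1 then ‖eulerTerm χ s D j l k‖ else 0

theorem localSum_nonneg (χ : Representation ℂ Γ V) (s : ℂ) (D : PrimitiveDatum Γ) (l k : ℕ) :
    0 ≤ localSum χ s D l k :=
  Finset.sum_nonneg fun j _ => by split_ifs <;> simp

/-- Reordering of the index set of the Euler product. -/
def indexEquiv (X F : Type*) : (X × ℕ × ℕ) × F ≃ X × F × ℕ × ℕ where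
  toFun x := (x.1.1, x.2, x.1.2)
  invFun x := ((x.1, x.2.2), x.2.1)
  left_inv _ := rfl
  right_inv _ := rfl

variable {R : ReducedSystem Γ} {χ : Representation ℂ Γ V} {s : ℂ}

theorem zetaConverges_iff : ZetaConverges R χ s ↔
    Summable fun x : R.carrier × ℕ × ℕ => localSum χ s x.1 x.2.1 x.2.2 := by
  classical
  let S : Set (R.carrier × Fin (Module.finrank ℂ V) × ℕ × ℕ) :=
    {p | coeffC χ p.1 p.2.1 p.2.2.1 p.2.2.2 = 1}
  let f : R.carrier × Fin (Module.finrank ℂ V) × ℕ × ℕ → ℝ :=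
    fun p => ‖eulerTerm χ s p.1 p.2.1 p.2.2.1 p.2.2.2‖
  have h1 : ZetaConverges R χ s ↔ Summable (S.indicator f) :=
    summable_subtype_iff_indicator (f := f) (s := S)
  have hnn : 0 ≤ S.indicator f ∘ indexEquiv R.carrier (Fin (Module.finrank ℂ V)) := fun x =>
    Set.indicator_nonneg (fun _ _ => norm_nonneg _) _
  rw [h1, ← (indexEquiv R.carrier (Fin (Module.finrank ℂ V))).summable_iff,
    summable_prod_of_nonneg hnn]
  simp only [tsum_fintype]
  rw [and_iff_right fun x => Summable.of_finite]
  rfl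

/-- Absolute convergence makes the product unconditional, so the finitely many factors over each
(T₀, l, k) may be multiplied first. All later identities compare these finite products. -/
theorem hasProd_selbergZeta (h : ZetaConverges R χ s) :
    HasProd (fun x : R.carrier × ℕ × ℕ => localProd χ s x.1 x.2.1 x.2.2)
      (selbergZeta R χ s) := by
  classical
  let S : Set (R.carrier × Fin (Module.finrank ℂ V) × ℕ × ℕ) :=
    {p | coeffC χ p.1 p.2.1 p.2.2.1 p.2.2.2 = 1}
  let f : R.carrier × Fin (Module.finrank ℂ V) × ℕ × ℕ → ℂ :=
    fun p => 1 - eulerTerm χ s p.1 p.2.1 p.2.2.1 p.2.2.2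
  have hm : Multipliable fun p : EulerIndex R χ => 1 - termAt R χ s p := by
    simp only [sub_eq_add_neg]
    exact multipliable_one_add_of_summable (by simpa using! h)
  have h1 : HasProd (S.mulIndicator f) (selbergZeta R χ s) :=
    (hasProd_subtype_iff_mulIndicator (f := f) (s := S)).1 hm.hasProd
  rw [← (indexEquiv R.carrier (Fin (Module.finrank ℂ V))).hasProd_iff] at h1
  exact h1.prod_fiberwise fun x => hasProd_fintype _

end EulerProduct

/-! ### Absolute convergence of twisted products. -/

section Comparison

open Classical in
-- If r is the least exponent with e u^r = 1, replacing l by l - r turns the twisted condition into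
-- the untwisted one. The replacement is injective for each x, and it can only increase a weight
-- that is antitone in l.
theorem summable_shift {X : Type*} {u : X → ℂ} (hu : ∀ x, u x ≠ 0) (e : X → ℂ)
    {w : X → ℕ → ℕ → ℝ} (hw : ∀ x l k, 0 ≤ w x l k) (hanti : ∀ x k, Antitone fun l => w x l k)
    (h : Summable fun x : X × ℕ × ℕ =>
      if u x.1 ^ x.2.1 = u x.1 ^ x.2.2 then w x.1 x.2.1 x.2.2 else 0) :
    Summable fun x : X × ℕ × ℕ =>
      if e x.1 * u x.1 ^ x.2.1 = u x.1 ^ x.2.2 ∧ x.2.2 ≤ x.2.1 then w x.1 x.2.1 x.2.2 else 0 := by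
  let S : Set (X × ℕ × ℕ) := {x | e x.1 * u x.1 ^ x.2.1 = u x.1 ^ x.2.2 ∧ x.2.2 ≤ x.2.1}
  -- The infimum is 0 when no exponent exists; only points of `S` are used, where l - k is such an
  -- exponent.
  let r : X → ℕ := fun x => sInf {d | e x * u x ^ d = 1}
  have hmem : ∀ x ∈ S, e x.1 * u x.1 ^ (x.2.1 - x.2.2) = 1 := by
    rintro ⟨x, l, k⟩ ⟨h1, h2⟩
    simp only at h1 h2 ⊢
    apply mul_right_cancel₀ (pow_ne_zero k (hu x))
    rw [mul_assoc, ← pow_add, Nat.sub_add_cancel h2, h1, one_mul]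
  have hr : ∀ x ∈ S, e x.1 * u x.1 ^ r x.1 = 1 := fun x hx =>
    Nat.sInf_mem (s := {d | e x.1 * u x.1 ^ d = 1}) ⟨_, hmem x hx⟩
  have hle : ∀ x ∈ S, r x.1 ≤ x.2.1 := fun x hx =>
    (Nat.sInf_le (hmem x hx)).trans (Nat.sub_le _ _)
  let σ : S → X × ℕ × ℕ := fun x => (x.1.1, x.1.2.1 - r x.1.1, x.1.2.2)
  have hσ : Function.Injective σ := by
    rintro ⟨⟨x, l, k⟩, hx⟩ ⟨⟨y, l', k'⟩, hy⟩ hxy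
    simp only [σ, Prod.mk.injEq] at hxy
    obtain ⟨rfl, h1, rfl⟩ := hxy
    have h2 := hle _ hx
    have h3 := hle _ hy
    simp only at h2 h3
    have : l = l' := by omega
    rw [Subtype.mk.injEq, this]
  have key : Summable ((fun x : X × ℕ × ℕ => w x.1 x.2.1 x.2.2) ∘ ((↑) : S → X × ℕ × ℕ)) := by
    refine Summable.of_nonneg_of_le (fun x => hw _ _ _) (fun x => ?_) (h.comp_injective hσ)
    have h1 : u x.1.1 ^ (x.1.2.1 - r x.1.1) = u x.1.1 ^ x.1.2.2 := by
      rw [← x.2.1]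
      nth_rw 2 [← Nat.sub_add_cancel (hle _ x.2)]
      rw [pow_add, mul_left_comm, hr _ x.2, mul_one]
    simp only [Function.comp_apply, σ, if_pos h1]
    exact hanti _ _ (Nat.sub_le _ _)
  refine (summable_subtype_iff_indicator.1 key).congr fun x => ?_
  by_cases hx : x ∈ S
  · exact (Set.indicator_of_mem hx _).trans (if_pos hx).symm
  · exact (Set.indicator_of_notMem hx _).trans (if_neg hx).symm

open Classical in
-- The range k ≤ l is `summable_shift`; the range l ≤ k is the same statement with l and k exchanged
-- and e replaced by its inverse.
theorem summable_twist {X : Type*} {u : X → ℂ} (hu : ∀ x, u x ≠ 0) (e : X → ℂ)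
    {w : X → ℕ → ℕ → ℝ} (hw : ∀ x l k, 0 ≤ w x l k) (hanti : ∀ x k, Antitone fun l => w x l k)
    (hanti' : ∀ x l, Antitone fun k => w x l k)
    (h : Summable fun x : X × ℕ × ℕ =>
      if u x.1 ^ x.2.1 = u x.1 ^ x.2.2 then w x.1 x.2.1 x.2.2 else 0) :
    Summable fun x : X × ℕ × ℕ =>
      if e x.1 * u x.1 ^ x.2.1 = u x.1 ^ x.2.2 then w x.1 x.2.1 x.2.2 else 0 := by
  let τ : X × ℕ × ℕ ≃ X × ℕ × ℕ := (Equiv.refl X).prodCongr (Equiv.prodComm ℕ ℕ)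
  have h1 := summable_shift hu e hw hanti h
  have h2 := summable_shift hu (fun x => (e x)⁻¹) (w := fun x l k => w x k l)
    (fun x l k => hw x k l) hanti' (by simpa [τ, Function.comp_def, eq_comm] using τ.summable_iff.2 h)
  rw [← τ.summable_iff] at h2
  refine Summable.of_nonneg_of_le (fun x => ?_) (fun x => ?_) (h1.add h2)
  · split_ifs
    exacts [hw _ _ _, le_rfl]
  · obtain ⟨x, l, k⟩ := x
    change (if e x * u x ^ l = u x ^ k then w x l k else 0) ≤
      (if e x * u x ^ l = u x ^ k ∧ k ≤ l then w x l k else 0) +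
        if (e x)⁻¹ * u x ^ k = u x ^ l ∧ l ≤ k then w x l k else 0
    have hnn : ∀ p : Prop, [Decidable p] → 0 ≤ if p then w x l k else 0 := fun p _ => by
      split_ifs
      exacts [hw _ _ _, le_rfl]
    by_cases hc : e x * u x ^ l = u x ^ k
    · rw [if_pos hc]
      rcases le_total k l with hkl | hkl
      · rw [if_pos ⟨hc, hkl⟩]
        linarith [hnn ((e x)⁻¹ * u x ^ k = u x ^ l ∧ l ≤ k)]
      · have he : e x ≠ 0 := fun h0 => pow_ne_zero k (hu x) (by rw [← hc, h0, zero_mul])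
        rw [if_pos (c := (e x)⁻¹ * u x ^ k = u x ^ l ∧ l ≤ k)
          ⟨by rw [← hc, inv_mul_cancel_left₀ he], hkl⟩]
        linarith [hnn (e x * u x ^ l = u x ^ k ∧ k ≤ l)]
    · rw [if_neg hc]
      exact add_nonneg (hnn _) (hnn _)

variable {Γ : Subgroup PSL(2, ℂ)} {V : Type*} [AddCommGroup V] [Module ℂ V]

theorem coeffC_eq_one_iff (χ : Representation ℂ Γ V) (D : PrimitiveDatum Γ)
    (j : Fin (Module.finrank ℂ V)) (l k : ℕ) :
    coeffC χ D j l k = 1 ↔ eigE χ D j * ((D.ζ : ℂ) ^ 2) ^ l = ((D.ζ : ℂ) ^ 2) ^ k := by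
  have hζ : (D.ζ : ℂ) ≠ 0 := D.ζ.ne_zero
  have h1 : (D.ζ : ℂ) ^ (2 * (l : ℤ)) = ((D.ζ : ℂ) ^ 2) ^ l := by
    rw [zpow_mul, zpow_natCast]; norm_cast
  have h2 : (D.ζ : ℂ) ^ (-2 * (k : ℤ)) = (((D.ζ : ℂ) ^ 2) ^ k)⁻¹ := by
    rw [neg_mul, zpow_neg, zpow_mul, zpow_natCast]; norm_cast
  rw [coeffC, h1, h2, mul_inv_eq_one₀ (pow_ne_zero _ (pow_ne_zero _ hζ))]

/-- The absolute value of the term of the Euler product with eigenvalue `1`. -/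
def weight (s : ℂ) (D : PrimitiveDatum Γ) (l k : ℕ) : ℝ :=
  (‖(D.a : ℂ)‖⁻¹ ^ 2) ^ k * (‖(D.a : ℂ)‖⁻¹ ^ 2) ^ l * ‖(D.N : ℂ) ^ (-s - 1)‖

theorem norm_eulerTerm (χ : Representation ℂ Γ V) (s : ℂ) (D : PrimitiveDatum Γ)
    (j : Fin (Module.finrank ℂ V)) (l k : ℕ) :
    ‖eulerTerm χ s D j l k‖ = ‖eigT χ D j‖ * weight s D l k := by
  have h : ∀ k : ℕ, ‖(D.a : ℂ)‖ ^ (-2 * (k : ℤ)) = (‖(D.a : ℂ)‖⁻¹ ^ 2) ^ k := fun k => by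
    rw [neg_mul, zpow_neg, zpow_mul, zpow_natCast, inv_pow, inv_pow]; norm_cast
  rw [eulerTerm, weight, norm_mul, norm_mul, norm_mul, RCLike.norm_conj, norm_zpow, norm_zpow, h, h]
  ring

theorem weight_nonneg (s : ℂ) (D : PrimitiveDatum Γ) (l k : ℕ) : 0 ≤ weight s D l k := by
  unfold weight
  positivity

theorem antitone_pow_inv_norm (D : PrimitiveDatum Γ) :
    Antitone fun k : ℕ => (‖(D.a : ℂ)‖⁻¹ ^ 2) ^ k :=
  pow_right_anti₀ (by positivity) (pow_le_one₀ (by positivity)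
    (inv_le_one_of_one_le₀ D.one_lt_norm.le))

theorem weight_antitone_left (s : ℂ) (D : PrimitiveDatum Γ) (k : ℕ) :
    Antitone fun l => weight s D l k := fun _ _ hl =>
  mul_le_mul_of_nonneg_right (mul_le_mul_of_nonneg_left (antitone_pow_inv_norm D hl)
    (by positivity)) (norm_nonneg _)

theorem weight_antitone_right (s : ℂ) (D : PrimitiveDatum Γ) (l : ℕ) :
    Antitone fun k => weight s D l k := fun _ _ hk =>
  mul_le_mul_of_nonneg_right (mul_le_mul_of_nonneg_right (antitone_pow_inv_norm D hk)
    (by positivity)) (norm_nonneg _)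

theorem jointEigenvalues_trivial (D : PrimitiveDatum Γ) (j) :
    jointEigenvalues (Representation.trivial ℂ Γ ℂ D.T₀) (Representation.trivial ℂ Γ ℂ D.E) j
      = (1, 1) := by
  obtain ⟨σ, hσ⟩ := exists_equiv_jointEigenvalues (A := Representation.trivial ℂ Γ ℂ D.T₀)
    (B := Representation.trivial ℂ Γ ℂ D.E)
    (Module.Basis.singleton Unit ℂ) (p := fun _ => (1, 1)) (by simp)
  rw [← σ.apply_symm_apply j, hσ]

open Classical in
theorem localSum_trivial_eq_weight (s : ℂ) (D : PrimitiveDatum Γ) (l k : ℕ) :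
    localSum (Representation.trivial ℂ Γ ℂ) s D l k =
      if ((D.ζ : ℂ) ^ 2) ^ l = ((D.ζ : ℂ) ^ 2) ^ k then weight s D l k else 0 := by
  unfold localSum
  simp only [coeffC_eq_one_iff, norm_eulerTerm, eigT, eigE, jointEigenvalues_trivial]
  simp

/-- A bounded twist does not spoil absolute convergence. -/
theorem ZetaConverges.of_trivial {R : ReducedSystem Γ} {χ : Representation ℂ Γ V} {s : ℂ}
    (h : ZetaConverges R (Representation.trivial ℂ Γ ℂ) s)
    (hχ : ∀ D j, ‖eigT χ D j‖ ≤ 1) : ZetaConverges R χ s := by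
  classical
  rw [zetaConverges_iff] at h ⊢
  simp only [localSum_trivial_eq_weight] at h
  refine summable_sum fun j _ => ?_
  have h1 := summable_twist (X := R.carrier) (u := fun D => (D.1.ζ : ℂ) ^ 2)
    (fun D => pow_ne_zero _ D.1.ζ.ne_zero) (fun D => eigE χ D j) (w := fun D => weight s D.1)
    (fun D => weight_nonneg s D.1)
    (fun D => weight_antitone_left s D.1) (fun D => weight_antitone_right s D.1) h
  refine Summable.of_nonneg_of_le (fun x => ?_) (fun x => ?_) h1
  · split_ifs <;> simp
  · simp only [coeffC_eq_one_iff, norm_eulerTerm]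
    split_ifs
    · exact mul_le_of_le_one_left (weight_nonneg _ _ _ _) (hχ _ _)
    · exact le_rfl

end Comparison

/-! ### The diagonal torus of PSL(2, ℂ) and the group of an axis. -/

section Torus

theorem coe_diagSL (a : ℂˣ) :
    (diagSL a : Matrix (Fin 2) (Fin 2) ℂ) = !![(a : ℂ), 0; 0, (a : ℂ)⁻¹] := rfl

/-- `diagPSL` as a homomorphism. -/
def diagHom : ℂˣ →* PSL(2, ℂ) :=
  (QuotientGroup.mk' _).comp
    { toFun := diagSL
      map_one' := by
        ext i j
        fin_cases i <;> fin_cases j <;> simp [coe_diagSL]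
      map_mul' := fun a b => by
        ext i j
        rw [Matrix.SpecialLinearGroup.coe_mul]
        fin_cases i <;> fin_cases j <;> simp [coe_diagSL, mul_comm] }

theorem diagPSL_eq (a : ℂˣ) : diagPSL a = diagHom a := rfl

theorem mk_eq_mk_iff (M M' : SL(2, ℂ)) :
    (QuotientGroup.mk M : PSL(2, ℂ)) = QuotientGroup.mk M' ↔
      ∃ r : ℂ, r ^ 2 = 1 ∧ ∀ i j, M' i j = r * M i j := by
  rw [QuotientGroup.eq, Matrix.SpecialLinearGroup.mem_center_iff]
  refine exists_congr fun r => and_congr (by simp) ?_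
  constructor
  · intro h i j
    have h1 : (M * (M⁻¹ * M') : SL(2, ℂ)) = M' := mul_inv_cancel_left M M'
    have h2 : (M : Matrix (Fin 2) (Fin 2) ℂ) * Matrix.scalar (Fin 2) r = M' := by
      rw [h, ← Matrix.SpecialLinearGroup.coe_mul, h1]
    rw [← h2, Matrix.scalar_apply, Matrix.mul_diagonal, mul_comm]
  · intro h
    have h1 : (M' : Matrix (Fin 2) (Fin 2) ℂ) = M * Matrix.scalar (Fin 2) r := by
      ext i j
      rw [h, Matrix.scalar_apply, Matrix.mul_diagonal, mul_comm]
    rw [Matrix.SpecialLinearGroup.coe_mul, h1, ← mul_assoc, ← Matrix.SpecialLinearGroup.coe_mul,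
      inv_mul_cancel, Matrix.SpecialLinearGroup.coe_one, one_mul]

theorem diagHom_eq_iff (a b : ℂˣ) : diagHom a = diagHom b ↔ a ^ 2 = b ^ 2 := by
  rw [← diagPSL_eq, ← diagPSL_eq, diagPSL, diagPSL, mk_eq_mk_iff, Units.ext_iff]
  push_cast
  constructor
  · rintro ⟨r, hr, h⟩
    have := h 0 0
    simp only [coe_diagSL, Matrix.of_apply, Matrix.cons_val', Matrix.cons_val_zero] at this
    rw [this, mul_pow, hr, one_mul]
  · intro h
    have hb : (b : ℂ) ≠ 0 := b.ne_zero
    have ha : (a : ℂ) ≠ 0 := a.ne_zero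
    refine ⟨b / a, by rw [div_pow, h, div_self (pow_ne_zero _ hb)], ?_⟩
    intro i j
    fin_cases i <;> fin_cases j <;> simp [coe_diagSL]
    field_simp
    exact h

/-- An element that conjugates one diagonal loxodromic element to another, respecting the
directions, is diagonal. -/
theorem exists_eq_diagHom_of_conj {g : PSL(2, ℂ)} {a b : ℂˣ} (ha : 1 < ‖(a : ℂ)‖)
    (hb : 1 < ‖(b : ℂ)‖) (h : g * diagHom a * g⁻¹ = diagHom b) : ∃ c, g = diagHom c := by
  obtain ⟨M, rfl⟩ := QuotientGroup.mk_surjective g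
  rw [mul_inv_eq_iff_eq_mul] at h
  have h' : (QuotientGroup.mk (M * diagSL a) : PSL(2, ℂ)) = QuotientGroup.mk (diagSL b * M) := h
  rw [mk_eq_mk_iff] at h'
  obtain ⟨r, hr, h'⟩ := h'
  have hr1 : ‖r‖ = 1 := by
    have : ‖r‖ ^ 2 = 1 := by rw [← norm_pow, hr, norm_one]
    exact (pow_eq_one_iff_of_nonneg (norm_nonneg _) two_ne_zero).1 this
  have ha0 : (a : ℂ) ≠ 0 := a.ne_zero
  have hb0 : (b : ℂ) ≠ 0 := b.ne_zero
  have hab : 1 < ‖(a : ℂ) * b‖ := by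
    rw [norm_mul]
    nlinarith
  have h01 := h' 0 1
  have h10 := h' 1 0
  simp only [Matrix.SpecialLinearGroup.coe_mul, coe_diagSL, Matrix.mul_apply, Fin.sum_univ_two,
    Matrix.of_apply, Matrix.cons_val', Matrix.cons_val_zero, Matrix.cons_val_one,
    Matrix.cons_val_fin_one, zero_mul, mul_zero, add_zero, zero_add] at h01 h10
  -- A nonzero off-diagonal entry would force ab = r or abr = 1, impossible since |ab| > 1 and the
  -- sign r has absolute value 1.
  have hM01 : M 0 1 = 0 := by
    by_contra hne
    field_simp at h01
    rw [mul_comm, h01, hr1] at hab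
    exact lt_irrefl _ hab
  have hM10 : M 1 0 = 0 := by
    by_contra hne
    field_simp at h10
    have h2 := congrArg norm (h10.trans (by ring : _ = (a : ℂ) * b * r))
    rw [norm_mul _ r, hr1, norm_one] at h2
    linarith
  have hdet := M.det_coe
  rw [Matrix.det_fin_two, hM01, zero_mul, sub_zero] at hdet
  have h0 : M 0 0 ≠ 0 := fun h => by simp [h] at hdet
  refine ⟨Units.mk0 _ h0, congrArg QuotientGroup.mk ?_⟩
  ext i j
  fin_cases i <;> fin_cases j <;> simp [coe_diagSL, hM01, hM10]
  exact eq_inv_of_mul_eq_one_right hdet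

/-- The elements of `Γ` that `g` conjugates to diagonal ones. -/
def axisGroup (Γ : Subgroup PSL(2, ℂ)) (g : PSL(2, ℂ)) : Subgroup Γ :=
  diagHom.range.comap ((MulAut.conj g).toMonoidHom.comp Γ.subtype)

variable {Γ : Subgroup PSL(2, ℂ)} {g : PSL(2, ℂ)}

theorem mem_axisGroup {x : Γ} : x ∈ axisGroup Γ g ↔ ∃ c, g * x * g⁻¹ = diagHom c := by
  simp [axisGroup, eq_comm]

theorem exists_multiplier (x : axisGroup Γ g) : ∃ c, g * (x : Γ) * g⁻¹ = diagHom c :=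
  mem_axisGroup.1 x.2

/-- The multiplier `c²` of an element that `g` conjugates to `diag(c, c⁻¹)`. -/
def multiplier (Γ : Subgroup PSL(2, ℂ)) (g : PSL(2, ℂ)) : axisGroup Γ g →* ℂˣ :=
  MonoidHom.mk' (fun x => (exists_multiplier x).choose ^ 2) fun x y => by
    rw [← mul_pow, ← diagHom_eq_iff, ← (exists_multiplier (x * y)).choose_spec, map_mul,
      ← (exists_multiplier x).choose_spec, ← (exists_multiplier y).choose_spec]
    simp [mul_assoc]

theorem multiplier_eq {x : axisGroup Γ g} {c : ℂˣ} (h : g * (x : Γ) * g⁻¹ = diagHom c) :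
    multiplier Γ g x = c ^ 2 := by
  change (exists_multiplier x).choose ^ 2 = _
  rw [← diagHom_eq_iff, ← (exists_multiplier x).choose_spec, h]

theorem multiplier_injective : Function.Injective (multiplier Γ g) := by
  intro x y h
  obtain ⟨c, hc⟩ := exists_multiplier x
  obtain ⟨d, hd⟩ := exists_multiplier y
  rw [multiplier_eq hc, multiplier_eq hd, ← diagHom_eq_iff, ← hc, ← hd] at h
  exact Subtype.ext (Subtype.ext (mul_left_cancel (mul_right_cancel h)))

/-- An element commuting with T conjugates diag(a, a⁻¹) to itself in the frame g, hence is diagonal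
there by `exists_eq_diagHom_of_conj`; conversely the torus is commutative. -/
theorem centralizer_eq_axisGroup {T : Γ} {a : ℂˣ} (ha : 1 < ‖(a : ℂ)‖)
    (h : g * T * g⁻¹ = diagHom a) : Subgroup.centralizer {T} = axisGroup Γ g := by
  ext x
  rw [Subgroup.mem_centralizer_singleton_iff, mem_axisGroup]
  constructor
  · intro hx
    have hx' : (x : PSL(2, ℂ)) * T = T * x := congrArg Subtype.val hx
    refine exists_eq_diagHom_of_conj ha ha ?_
    rw [← h]
    calc _ = g * (x * T) * (x : PSL(2, ℂ))⁻¹ * g⁻¹ := by group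
      _ = _ := by rw [hx']; group
  · rintro ⟨c, hc⟩
    have h1 : (g * x * g⁻¹) * (g * T * g⁻¹) = (g * T * g⁻¹) * (g * x * g⁻¹) := by
      rw [hc, h, ← map_mul, ← map_mul, mul_comm]
    have h2 : g * (x * T : PSL(2, ℂ)) * g⁻¹ = g * (T * x) * g⁻¹ := by
      simpa [mul_assoc] using h1
    exact Subtype.ext (mul_left_cancel (mul_right_cancel h2))

end Torus

/-! ### Primitive data described by diagonalizing frames. -/

section Frame

variable {Γ : Subgroup PSL(2, ℂ)}

/-- An element that conjugates `T₀` and `E` to diagonal form. -/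
def PrimitiveDatum.frame (D : PrimitiveDatum Γ) : PSL(2, ℂ) := D.exists_conj.choose

variable (D D' : PrimitiveDatum Γ)

theorem PrimitiveDatum.frame_T₀ : D.frame * D.T₀ * D.frame⁻¹ = diagHom D.a :=
  D.exists_conj.choose_spec.1

theorem PrimitiveDatum.frame_E : D.frame * D.E * D.frame⁻¹ = diagHom D.ζ :=
  D.exists_conj.choose_spec.2

theorem PrimitiveDatum.centralizer_eq_axisGroup :
    Subgroup.centralizer {D.T₀} = axisGroup Γ D.frame :=
  SelbergZeta.centralizer_eq_axisGroup D.one_lt_norm D.frame_T₀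

/-- `T₀` in the group of its axis. -/
def PrimitiveDatum.axisT : axisGroup Γ D.frame := ⟨D.T₀, mem_axisGroup.2 ⟨_, D.frame_T₀⟩⟩

/-- `E` in the group of the axis of `T₀`. -/
def PrimitiveDatum.axisE : axisGroup Γ D.frame := ⟨D.E, mem_axisGroup.2 ⟨_, D.frame_E⟩⟩

theorem PrimitiveDatum.multiplier_axisT : multiplier Γ D.frame D.axisT = D.a ^ 2 :=
  multiplier_eq D.frame_T₀

theorem PrimitiveDatum.multiplier_axisE : multiplier Γ D.frame D.axisE = D.ζ ^ 2 :=
  multiplier_eq D.frame_E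

theorem PrimitiveDatum.isOfFinOrder_axisE : IsOfFinOrder D.axisE :=
  (Subgroup.subtype_injective _).isOfFinOrder_iff.1 D.isOfFinOrder

/-- E has finite order, so its multiplier ζ² is a root of unity. This allows ζ^{2l} to be written as
the conjugate of ζ^{-2l} in `coeffC_eq`. -/
theorem PrimitiveDatum.norm_ζ : ‖(D.ζ : ℂ)‖ = 1 := by
  have h := (multiplier Γ D.frame).isOfFinOrder D.isOfFinOrder_axisE
  rw [multiplier_axisE, isOfFinOrder_pow] at h
  rcases h with h | h
  · obtain ⟨n, hn, hz⟩ := isOfFinOrder_iff_pow_eq_one.1 h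
    have h1 : ‖(D.ζ : ℂ)‖ ^ n = 1 := by
      rw [← norm_pow, ← Units.val_pow_eq_pow_val, hz, Units.val_one, norm_one]
    exact (pow_eq_one_iff_of_nonneg (norm_nonneg _) hn.ne').1 h1
  · simp at h

theorem PrimitiveDatum.commute_T₀_E : Commute D.T₀ D.E := by
  have h : Commute D.axisT D.axisE := multiplier_injective (by rw [map_mul, map_mul, mul_comm])
  exact h.map (Subgroup.subtype _)

theorem PrimitiveDatum.exists_zpow_mul_zpow (x : axisGroup Γ D.frame) :
    ∃ m n : ℤ, x = D.axisT ^ m * D.axisE ^ n := by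
  have hcomm : ∀ m n, Commute (zpowersHom Γ D.T₀ m) (zpowersHom Γ D.E n) := by
    intro m n
    exact D.commute_T₀_E.zpow_zpow m.toAdd n.toAdd
  obtain ⟨x, hx⟩ := x
  have hT : ∀ y : Γ, Subgroup.zpowers y = (zpowersHom Γ y).range := fun y => by
    ext z
    simp [Subgroup.mem_zpowers_iff, MonoidHom.mem_range, Multiplicative.exists]
  rw [← D.centralizer_eq_axisGroup, D.centralizer_eq, hT, hT,
    ← MonoidHom.noncommCoprod_range _ _ hcomm] at hx
  obtain ⟨⟨m, n⟩, hmn⟩ := hx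
  refine ⟨m.toAdd, n.toAdd, Subtype.ext ?_⟩
  exact hmn.symm

/-- A primitive datum from generators of the group of an axis. -/
theorem exists_primitiveDatum {g : PSL(2, ℂ)} (T E : axisGroup Γ g)
    (hT : 1 < ‖(multiplier Γ g T : ℂ)‖) (hE : IsOfFinOrder E)
    (hgen : ∀ x : axisGroup Γ g, ∃ m n : ℤ, x = T ^ m * E ^ n) :
    ∃ (D : PrimitiveDatum Γ) (c : ℂˣ), D.frame = diagHom c * g := by
  obtain ⟨a, ha⟩ := exists_multiplier T
  obtain ⟨ζ, hζ⟩ := exists_multiplier E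
  have ha1 : 1 < ‖(a : ℂ)‖ := by
    rw [multiplier_eq ha, Units.val_pow_eq_pow_val, norm_pow] at hT
    exact (one_lt_pow_iff_of_nonneg (norm_nonneg _) two_ne_zero).1 hT
  let D : PrimitiveDatum Γ :=
    { T₀ := T
      E := E
      a := a
      ζ := ζ
      one_lt_norm := ha1
      exists_conj := ⟨g, ha, hζ⟩
      isOfFinOrder := (Subgroup.subtype _).isOfFinOrder hE
      centralizer_eq := by
        rw [centralizer_eq_axisGroup ha1 ha]
        apply le_antisymm
        · intro x hx
          obtain ⟨m, n, h⟩ := hgen ⟨x, hx⟩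
          have h' : x = (T : Γ) ^ m * (E : Γ) ^ n := congrArg Subtype.val h
          rw [h']
          exact Subgroup.mul_mem_sup (Subgroup.zpow_mem_zpowers _ _)
            (Subgroup.zpow_mem_zpowers _ _)
        · rw [sup_le_iff, Subgroup.zpowers_le, Subgroup.zpowers_le]
          exact ⟨T.2, E.2⟩ }
  have hD : D.frame * T * D.frame⁻¹ = diagHom a := D.frame_T₀
  obtain ⟨c, hc⟩ : ∃ c, D.frame * g⁻¹ = diagHom c := by
    refine exists_eq_diagHom_of_conj ha1 ha1 ?_
    rw [← ha]
    calc _ = D.frame * T * D.frame⁻¹ := by group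
      _ = _ := by rw [hD, ha]
  exact ⟨D, c, by rw [← hc, inv_mul_cancel_right]⟩

/-- Axis equivalence in terms of the frames. -/
theorem axisEquiv_iff : AxisEquiv D.T₀ D'.T₀ ↔
    ∃ (δ : Γ) (c : ℂˣ), D'.frame = diagHom c * D.frame * δ := by
  constructor
  · rintro ⟨γ, -, g, a, a', ha, ha', h, h'⟩
    -- Two frames that diagonalize a loxodromic element with the same direction differ by a diagonal
    -- factor on the left.
    obtain ⟨c, hc⟩ : ∃ c, g * γ * D.frame⁻¹ = diagHom c := by
      refine exists_eq_diagHom_of_conj D.one_lt_norm ha ?_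
      rw [← diagPSL_eq a, ← h, ← D.frame_T₀]
      push_cast
      group
    obtain ⟨c', hc'⟩ : ∃ c, g * D'.frame⁻¹ = diagHom c := by
      refine exists_eq_diagHom_of_conj D'.one_lt_norm ha' ?_
      rw [← diagPSL_eq a', ← h', ← D'.frame_T₀]
      group
    refine ⟨γ⁻¹, c'⁻¹ * c, ?_⟩
    rw [map_mul, map_inv, ← hc, ← hc']
    push_cast
    group
  · rintro ⟨δ, c, hc⟩
    have h : D'.frame * (δ⁻¹ * D.T₀ * δ⁻¹⁻¹ : Γ) * D'.frame⁻¹ = diagHom D.a := by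
      have h1 : D'.frame * (δ⁻¹ * D.T₀ * δ⁻¹⁻¹ : Γ) * D'.frame⁻¹ =
          diagHom c * (D.frame * D.T₀ * D.frame⁻¹) * (diagHom c)⁻¹ := by
        rw [hc]
        push_cast
        group
      rw [h1, D.frame_T₀, ← map_inv, ← map_mul, ← map_mul, mul_inv_cancel_comm]
    refine ⟨δ⁻¹, ?_, D'.frame, D.a, D'.a, D.one_lt_norm, D'.one_lt_norm, h, D'.frame_T₀⟩
    rw [centralizer_eq_axisGroup D.one_lt_norm h, D'.centralizer_eq_axisGroup]

end Frame

/-! ### Generators of a group with a degree and bounded torsion. -/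

section Generators

variable {C : Type*} [Group C]

theorem exists_degree (h : C →* ℝ) {q : ℝ} (hq : 1 < q) (hC : ∀ c, ∃ m : ℤ, h c = q ^ m) :
    ∃ deg : C →* Multiplicative ℤ, ∀ c, h c = q ^ (deg c).toAdd := by
  choose m hm using hC
  refine ⟨MonoidHom.mk' (fun c => Multiplicative.ofAdd (m c)) fun x y => ?_, hm⟩
  rw [← ofAdd_add, Multiplicative.ofAdd.injective.eq_iff]
  apply zpow_right_injective₀ (zero_lt_one.trans hq) hq.ne'
  simp only
  rw [zpow_add₀ (zero_lt_one.trans hq).ne', ← hm, ← hm, ← hm, map_mul]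

/-- The kernel of the degree embeds by ν into the M-th roots of unity, so it is finite cyclic and
supplies E. The image of the degree is a nontrivial cyclic subgroup of ℤ and supplies T, inverted if
its degree is negative. -/
theorem exists_generators {ν : C →* ℂˣ} (hν : Function.Injective ν) (deg : C →* Multiplicative ℤ)
    {x : C} (hx : deg x ≠ 1) {M : ℕ} (hM : M ≠ 0) (htors : ∀ c, deg c = 1 → c ^ M = 1) :
    ∃ T E : C, 0 < (deg T).toAdd ∧ IsOfFinOrder E ∧ ∀ c, ∃ m n : ℤ, c = T ^ m * E ^ n := by
  have : NeZero M := ⟨hM⟩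
  let f : deg.ker →* rootsOfUnity M ℂ := (ν.comp deg.ker.subtype).codRestrict _ fun c => by
    rw [mem_rootsOfUnity, ← map_pow]
    exact (congrArg ν (htors _ c.2)).trans (map_one ν)
  have hf : Function.Injective f := fun c d h => Subtype.ext (hν (congrArg Subtype.val h))
  have hfin : Finite deg.ker := Finite.of_injective f hf
  have hcyc : IsCyclic deg.ker := isCyclic_of_injective f hf
  obtain ⟨E, hE⟩ := hcyc.exists_generator
  obtain ⟨⟨_, T, rfl⟩, hT⟩ := (inferInstance : IsCyclic deg.range).exists_generator
  have hgen : ∀ c, ∃ m : ℤ, deg c = deg T ^ m := fun c => by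
    obtain ⟨m, hm⟩ := Subgroup.mem_zpowers_iff.1 (hT ⟨deg c, c, rfl⟩)
    exact ⟨m, (congrArg Subtype.val hm).symm⟩
  have hT0 : (deg T).toAdd ≠ 0 := by
    intro h
    obtain ⟨m, hm⟩ := hgen x
    have h1 : deg T = 1 := h
    exact hx (by rw [hm, h1, one_zpow])
  obtain ⟨T', hT', hgen'⟩ : ∃ T', 0 < (deg T').toAdd ∧ ∀ c, ∃ m : ℤ, deg c = deg T' ^ m := by
    rcases lt_or_gt_of_ne hT0 with h | h
    · refine ⟨T⁻¹, by simpa using h, fun c => ?_⟩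
      obtain ⟨m, hm⟩ := hgen c
      exact ⟨-m, by simpa using hm⟩
    · exact ⟨T, h, hgen⟩
  refine ⟨T', E, hT', (Subgroup.subtype _).isOfFinOrder (isOfFinOrder_of_finite E), fun c => ?_⟩
  obtain ⟨m, hm⟩ := hgen' c
  have hk : (T' ^ m)⁻¹ * c ∈ deg.ker := by
    rw [MonoidHom.mem_ker, map_mul, map_inv, map_zpow, hm, inv_mul_cancel]
  obtain ⟨n, hn⟩ := Subgroup.mem_zpowers_iff.1 (hE ⟨_, hk⟩)
  have hn' : (E : C) ^ n = (T' ^ m)⁻¹ * c := congrArg Subtype.val hn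
  exact ⟨m, n, by rw [hn', mul_inv_cancel_left]⟩

end Generators

/-! ### The product over the characters of a finite abelian quotient. -/

section CharacterSum

variable {C A : Type*} [Group C] [CommGroup A]

/-- The product of a quasi-character of `C` and a character of a quotient of `C`. -/
def twist (π : C →* A) (φ : C →* ℂˣ) (ψ : AddChar (Additive A) ℂ) : C →* ℂ where
  toFun c := ψ (Additive.ofMul (π c)) * φ c
  map_one' := by simp
  map_mul' x y := by
    simp only [map_mul, ofMul_mul, AddChar.map_add_eq_mul, Units.val_mul]
    ring

theorem twist_apply (π : C →* A) (φ : C →* ℂˣ) (ψ : AddChar (Additive A) ℂ) (c : C) :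
    twist π φ ψ c = ψ (Additive.ofMul (π c)) * φ c := rfl

/-- `C` is generated by `T₀` of degree one and `E` of degree zero, and the kernel of the
surjective homomorphism `π` by `T₁` of positive degree and `E₁` of degree zero. -/
structure IsGeneratedBy (π : C →* A) (deg : C →* Multiplicative ℤ) (T₀ E T₁ E₁ : C) : Prop where
  surjective : Function.Surjective π
  gen : ∀ c, ∃ m n : ℤ, c = T₀ ^ m * E ^ n
  deg_T₀ : deg T₀ = Multiplicative.ofAdd 1
  deg_E : deg E = 1
  deg_T₁ : 0 < (deg T₁).toAdd
  deg_E₁ : deg E₁ = 1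
  map_T₁ : π T₁ = 1
  map_E₁ : π E₁ = 1
  gen_ker : ∀ c, π c = 1 → ∃ m n : ℤ, c = T₁ ^ m * E₁ ^ n

variable {π : C →* A} {deg : C →* Multiplicative ℤ} {T₀ E T₁ E₁ : C} {φ : C →* ℂˣ}

theorem IsGeneratedBy.eq_zpow (h : IsGeneratedBy π deg T₀ E T₁ E₁) (c : C) :
    ∃ n : ℤ, c = T₀ ^ (deg c).toAdd * E ^ n := by
  obtain ⟨m, n, hc⟩ := h.gen c
  have : (deg c).toAdd = m := by
    rw [hc, map_mul, map_zpow, map_zpow, h.deg_T₀, h.deg_E]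
    simp
  exact ⟨n, by rw [this]; exact hc⟩

theorem IsGeneratedBy.twist_eq (h : IsGeneratedBy π deg T₀ E T₁ E₁)
    {ψ : AddChar (Additive A) ℂ} (hψ : twist π φ ψ E = 1) (c : C) :
    twist π φ ψ c = twist π φ ψ T₀ ^ (deg c).toAdd := by
  obtain ⟨n, hn⟩ := h.eq_zpow c
  conv_lhs => rw [hn]
  rw [map_mul, map_zpow, map_zpow, hψ, one_zpow, mul_one]

theorem IsGeneratedBy.twist_ne_one (h : IsGeneratedBy π deg T₀ E T₁ E₁) (hE₁ : φ E₁ ≠ 1)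
    (ψ : AddChar (Additive A) ℂ) : twist π φ ψ E ≠ 1 := by
  intro hψ
  have h1 := h.twist_eq hψ E₁
  rw [h.deg_E₁, twist_apply, h.map_E₁] at h1
  exact hE₁ (Units.ext (by simpa using h1))

/-- The quotient of c ↦ x^{deg c} by φ is trivial on T₁ and E₁, hence on the kernel of π, and so
descends to the required character of A. -/
theorem IsGeneratedBy.exists_twist (h : IsGeneratedBy π deg T₀ E T₁ E₁) (hE₁ : φ E₁ = 1)
    {x : ℂˣ} (hx : x ^ (deg T₁).toAdd = φ T₁) :
    ∃ ψ : AddChar (Additive A) ℂ, twist π φ ψ T₀ = x ∧ twist π φ ψ E = 1 := by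
  let η : C →* ℂˣ := (zpowersHom ℂˣ x).comp deg / φ
  have hη : ∀ c, η c = x ^ (deg c).toAdd / φ c := fun _ => rfl
  have hker : π.ker ≤ η.ker := by
    intro c hc
    obtain ⟨m, n, rfl⟩ := h.gen_ker c hc
    rw [MonoidHom.mem_ker, map_mul, map_zpow, map_zpow, hη, hη, hx, h.deg_E₁, hE₁]
    simp
  let η' : A →* ℂˣ := π.liftOfSurjective h.surjective ⟨η, hker⟩
  have hη' : ∀ c, η' (π c) = η c := fun c =>
    MonoidHom.liftOfRightInverse_comp_apply _ _ _ ⟨η, hker⟩ c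
  let ψ : AddChar (Additive A) ℂ :=
    { toFun := fun a => η' a.toMul
      map_zero_eq_one' := by simp
      map_add_eq_mul' := fun a b => by simp }
  have hψ : ∀ c, twist π φ ψ c = ((x ^ (deg c).toAdd : ℂˣ) : ℂ) := fun c => by
    change ((η' (π c) : ℂˣ) : ℂ) * φ c = _
    rw [hη', hη, ← Units.val_mul, div_mul_cancel]
  exact ⟨ψ, by rw [hψ, h.deg_T₀]; simp, by rw [hψ, h.deg_E]; simp⟩

theorem IsGeneratedBy.twist_injective (h : IsGeneratedBy π deg T₀ E T₁ E₁)
    {ψ ψ' : AddChar (Additive A) ℂ} (hψ : twist π φ ψ E = 1) (hψ' : twist π φ ψ' E = 1)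
    (heq : twist π φ ψ T₀ = twist π φ ψ' T₀) : ψ = ψ' := by
  ext a
  obtain ⟨c, hc⟩ := h.surjective a.toMul
  have h1 := (h.twist_eq hψ c).trans ((congrArg (· ^ _) heq).trans (h.twist_eq hψ' c).symm)
  rw [twist_apply, twist_apply, hc] at h1
  exact mul_right_cancel₀ (φ c).ne_zero h1

theorem IsGeneratedBy.twist_pow (h : IsGeneratedBy π deg T₀ E T₁ E₁)
    {ψ : AddChar (Additive A) ℂ} (hψ : twist π φ ψ E = 1) :
    twist π φ ψ T₀ ^ (deg T₁).toAdd = φ T₁ := by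
  rw [← h.twist_eq hψ, twist_apply, h.map_T₁]
  simp

open Classical in
-- When a twist is trivial at E it is c ↦ x^{deg c} with x its value at T₀. Since ψ is trivial on
-- the kernel of π, evaluation at T₁ gives x^e = φ(T₁) and evaluation at E₁ gives φ(E₁) = 1.
-- Conversely every root x arises from exactly one ψ.
theorem IsGeneratedBy.prod_twist [Finite A] (h : IsGeneratedBy π deg T₀ E T₁ E₁) (φ : C →* ℂˣ) :
    ∏ ψ : AddChar (Additive A) ℂ, (if twist π φ ψ E = 1 then 1 - twist π φ ψ T₀ else 1) =
      if (φ E₁ : ℂ) = 1 then 1 - (φ T₁ : ℂ) else 1 := by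
  by_cases hE₁ : φ E₁ = 1
  · rw [if_pos (Units.val_eq_one.2 hE₁)]
    obtain ⟨e, he⟩ := Int.eq_ofNat_of_zero_le h.deg_T₁.le
    have hpos : 0 < e := by have := h.deg_T₁; omega
    have : NeZero e := ⟨hpos.ne'⟩
    obtain ⟨α, hα⟩ := IsAlgClosed.exists_pow_nat_eq (φ T₁ : ℂ) hpos
    have hα0 : α ≠ 0 := by
      rintro rfl
      rw [zero_pow hpos.ne'] at hα
      exact (φ T₁).ne_zero hα.symm
    have hζ := Complex.isPrimitiveRoot_exp e hpos.ne'
    set ζ := Complex.exp (2 * Real.pi * Complex.I / e)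
    -- The factorization of X^e - φ(T₁) over its roots ζ^i α, taken at X = 1.
    have key := congrArg (Polynomial.eval 1) (X_pow_sub_C_eq_prod hζ hpos hα)
    rw [Polynomial.eval_prod] at key
    simp only [Polynomial.eval_sub, Polynomial.eval_pow, Polynomial.eval_X, one_pow,
      Polynomial.eval_C] at key
    rw [key, ← Finset.prod_filter]
    have hroot : ∀ ψ, twist π φ ψ E = 1 → ∃ i < e, ζ ^ i * α = twist π φ ψ T₀ := by
      intro ψ hψ
      have h1 := h.twist_pow hψ
      rw [he, zpow_natCast] at h1
      have h2 : (twist π φ ψ T₀ / α) ^ e = 1 := by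
        rw [div_pow, hα, h1, div_self (φ T₁).ne_zero]
      obtain ⟨i, hi, hi'⟩ := hζ.eq_pow_of_pow_eq_one h2
      exact ⟨i, hi, by rw [hi', div_mul_cancel₀ _ hα0]⟩
    have hex : ∀ i, ∃ ψ, twist π φ ψ T₀ = ζ ^ i * α ∧ twist π φ ψ E = 1 := by
      intro i
      have h0 : ζ ^ i * α ≠ 0 := mul_ne_zero (pow_ne_zero _ (hζ.ne_zero hpos.ne')) hα0
      refine h.exists_twist hE₁ (x := Units.mk0 _ h0) (Units.ext ?_)
      rw [he]
      simp only [zpow_natCast, Units.val_pow_eq_pow_val, Units.val_mk0]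
      rw [mul_pow, hα, ← pow_mul, mul_comm i, pow_mul, hζ.pow_eq_one, one_pow, one_mul]
    choose Ψ hΨ hΨ' using hex
    refine (Finset.prod_bij (fun i _ => Ψ i) ?_ ?_ ?_ ?_).symm
    · intro i _
      simpa using hΨ' i
    · intro i hi j hj hij
      have h1 := congrArg (fun ψ => twist π φ ψ T₀) hij
      simp only [hΨ] at h1
      exact hζ.pow_inj (Finset.mem_range.1 hi) (Finset.mem_range.1 hj) (mul_right_cancel₀ hα0 h1)
    · intro ψ hψ
      have hψ' : twist π φ ψ E = 1 := by simpa using hψ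
      obtain ⟨i, hi, hi'⟩ := hroot ψ hψ'
      exact ⟨i, Finset.mem_range.2 hi, h.twist_injective (hΨ' i) hψ' ((hΨ i).trans hi')⟩
    · intro i _
      rw [hΨ]
  · rw [if_neg (mt Units.val_eq_one.1 hE₁)]
    exact Finset.prod_eq_one fun ψ _ => if_neg (h.twist_ne_one hE₁ ψ)

open Classical in
-- One root x of x^e = φ(T₁) suffices: |x| ≤ 1 and e ≥ 1 give |φ(T₁)| = |x|^e ≤ |x|.
theorem IsGeneratedBy.norm_le_sum_twist [Finite A] (h : IsGeneratedBy π deg T₀ E T₁ E₁)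
    (hφ : ‖(φ T₁ : ℂ)‖ ≤ 1) :
    (if (φ E₁ : ℂ) = 1 then ‖(φ T₁ : ℂ)‖ else 0) ≤
      ∑ ψ : AddChar (Additive A) ℂ, (if twist π φ ψ E = 1 then ‖twist π φ ψ T₀‖ else 0) := by
  have hnn : ∀ ψ : AddChar (Additive A) ℂ,
      0 ≤ if twist π φ ψ E = 1 then ‖twist π φ ψ T₀‖ else 0 := fun ψ => by
    split_ifs <;> simp
  by_cases hE₁ : φ E₁ = 1
  · rw [if_pos (Units.val_eq_one.2 hE₁)]
    obtain ⟨e, he⟩ := Int.eq_ofNat_of_zero_le h.deg_T₁.le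
    have hpos : 0 < e := by have := h.deg_T₁; omega
    obtain ⟨α, hα⟩ := IsAlgClosed.exists_pow_nat_eq (φ T₁ : ℂ) hpos
    have hα0 : α ≠ 0 := by
      rintro rfl
      rw [zero_pow hpos.ne'] at hα
      exact (φ T₁).ne_zero hα.symm
    obtain ⟨ψ, hψ, hψ'⟩ := h.exists_twist hE₁ (x := Units.mk0 α hα0) (Units.ext (by
      rw [he]
      simpa using hα))
    refine le_trans ?_ (Finset.single_le_sum (fun ψ _ => hnn ψ) (Finset.mem_univ ψ))
    rw [if_pos hψ', hψ, Units.val_mk0]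
    rw [← hα, norm_pow] at hφ ⊢
    exact pow_le_of_le_one (norm_nonneg _)
      ((pow_le_one_iff_of_nonneg (norm_nonneg _) hpos.ne').1 hφ) hpos.ne'
  · rw [if_neg (mt Units.val_eq_one.1 hE₁)]
    exact Finset.sum_nonneg fun ψ _ => hnn ψ

end CharacterSum

/-! ### Euler terms as values of a quasi-character of the multiplier. -/

section QuasiCharacter

/-- The quasi-character `z ↦ z^{-k} conj(z)^{-l} |z|^{-s-1}`. -/
def quasiChar (s : ℂ) (l k : ℕ) : ℂˣ →* ℂˣ :=
  MonoidHom.toHomUnits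
    { toFun := fun z => (z : ℂ) ^ (-(k : ℤ)) * conj ((z : ℂ) ^ (-(l : ℤ))) *
        ((‖(z : ℂ)‖ : ℝ) : ℂ) ^ (-s - 1)
      map_one' := by simp
      map_mul' := fun z w => by
        simp only [Units.val_mul, mul_zpow, map_mul, norm_mul, Complex.ofReal_mul]
        rw [Complex.mul_cpow_ofReal_nonneg (norm_nonneg _) (norm_nonneg _)]
        ring }

theorem quasiChar_apply (s : ℂ) (l k : ℕ) (z : ℂˣ) :
    (quasiChar s l k z : ℂ) = (z : ℂ) ^ (-(k : ℤ)) * conj ((z : ℂ) ^ (-(l : ℤ))) *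
        ((‖(z : ℂ)‖ : ℝ) : ℂ) ^ (-s - 1) := rfl

theorem norm_quasiChar_le {s : ℂ} (hs : -1 < s.re) (l k : ℕ) {z : ℂˣ} (hz : 1 ≤ ‖(z : ℂ)‖) :
    ‖(quasiChar s l k z : ℂ)‖ ≤ 1 := by
  have h : ∀ k : ℕ, ‖(z : ℂ)‖ ^ (-(k : ℤ)) ≤ 1 := fun k =>
    zpow_le_one_of_nonpos₀ hz (by simp)
  rw [quasiChar_apply, norm_mul, norm_mul, RCLike.norm_conj, norm_zpow, norm_zpow,
    Complex.norm_cpow_eq_rpow_re_of_pos (by linarith)]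
  refine mul_le_one₀ (mul_le_one₀ (h k) (by positivity) (h l)) (by positivity) ?_
  exact Real.rpow_le_one_of_one_le_of_nonpos hz (by simp; linarith)

variable {Γ : Subgroup PSL(2, ℂ)} {V : Type*} [AddCommGroup V] [Module ℂ V]

theorem eulerTerm_eq (χ : Representation ℂ Γ V) (s : ℂ) (D : PrimitiveDatum Γ)
    (j : Fin (Module.finrank ℂ V)) (l k : ℕ) :
    eulerTerm χ s D j l k = eigT χ D j * quasiChar s l k (D.a ^ 2) := by
  have h : ∀ k : ℕ, (D.a : ℂ) ^ (-2 * (k : ℤ)) = ((D.a : ℂ) ^ 2) ^ (-(k : ℤ)) := fun k => by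
    rw [← zpow_natCast, ← zpow_mul]
    congr 1
    push_cast
    ring
  rw [eulerTerm, quasiChar_apply, h, h, PrimitiveDatum.N, Units.val_pow_eq_pow_val, norm_pow]
  ring

/-- Because |ζ| = 1, the condition at E and the term at T₀ come from the same quasi-character; the
character sum applies to it. -/
theorem coeffC_eq (χ : Representation ℂ Γ V) (s : ℂ) (D : PrimitiveDatum Γ)
    (j : Fin (Module.finrank ℂ V)) (l k : ℕ) :
    coeffC χ D j l k = eigE χ D j * quasiChar s l k (D.ζ ^ 2) := by
  have h : ∀ k : ℕ, (D.ζ : ℂ) ^ (-2 * (k : ℤ)) = ((D.ζ : ℂ) ^ 2) ^ (-(k : ℤ)) := fun k => by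
    rw [← zpow_natCast, ← zpow_mul]
    congr 1
    push_cast
    ring
  have h' : (D.ζ : ℂ) ^ (2 * (l : ℤ)) = conj (((D.ζ : ℂ) ^ 2) ^ (-(l : ℤ))) := by
    rw [map_zpow₀, map_pow, ← Complex.inv_eq_conj D.norm_ζ, ← zpow_natCast, ← zpow_mul, inv_zpow']
    congr 1
    push_cast
    ring
  rw [coeffC, quasiChar_apply, h, h', Units.val_pow_eq_pow_val, norm_pow, D.norm_ζ]
  simp only [one_pow, Complex.ofReal_one, Complex.one_cpow, mul_one]
  ring

open Classical in
/-- The factor of the Euler product belonging to a pair of eigenvalues. -/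
def eulerFactor (s : ℂ) (D : PrimitiveDatum Γ) (l k : ℕ) (p : ℂ × ℂ) : ℂ :=
  if p.2 * quasiChar s l k (D.ζ ^ 2) = 1 then 1 - p.1 * quasiChar s l k (D.a ^ 2) else 1

open Classical in
/-- The absolute value of the term of the Euler product belonging to a pair of eigenvalues. -/
def eulerNorm (s : ℂ) (D : PrimitiveDatum Γ) (l k : ℕ) (p : ℂ × ℂ) : ℝ :=
  if p.2 * quasiChar s l k (D.ζ ^ 2) = 1 then ‖p.1 * quasiChar s l k (D.a ^ 2)‖ else 0

theorem localProd_eq (χ : Representation ℂ Γ V) (s : ℂ) (D : PrimitiveDatum Γ) (l k : ℕ) :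
    localProd χ s D l k = ∏ j, eulerFactor s D l k (jointEigenvalues (χ D.T₀) (χ D.E) j) := by
  simp only [localProd, eulerTerm_eq, coeffC_eq χ s]
  rfl

theorem localSum_eq (χ : Representation ℂ Γ V) (s : ℂ) (D : PrimitiveDatum Γ) (l k : ℕ) :
    localSum χ s D l k = ∑ j, eulerNorm s D l k (jointEigenvalues (χ D.T₀) (χ D.E) j) := by
  simp only [localSum, eulerTerm_eq, coeffC_eq χ s]
  rfl

theorem localProd_trivial (s : ℂ) (D : PrimitiveDatum Γ) (l k : ℕ) :
    localProd (Representation.trivial ℂ Γ ℂ) s D l k = eulerFactor s D l k (1, 1) := by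
  simp only [localProd_eq, jointEigenvalues_trivial]
  simp

theorem localSum_trivial_eq (s : ℂ) (D : PrimitiveDatum Γ) (l k : ℕ) :
    localSum (Representation.trivial ℂ Γ ℂ) s D l k = eulerNorm s D l k (1, 1) := by
  simp only [localSum_eq, jointEigenvalues_trivial]
  simp

end QuasiCharacter

/-! ### The degree on the group of an axis. -/

section Degree

variable {Γ : Subgroup PSL(2, ℂ)}

/-- The absolute value of the multiplier. -/
def normMultiplier (Γ : Subgroup PSL(2, ℂ)) (g : PSL(2, ℂ)) : axisGroup Γ g →* ℝ :=
  ((normHom : ℂ →*₀ ℝ) : ℂ →* ℝ).comp ((Units.coeHom ℂ).comp (multiplier Γ g))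

theorem normMultiplier_apply (g : PSL(2, ℂ)) (x : axisGroup Γ g) :
    normMultiplier Γ g x = ‖(multiplier Γ g x : ℂ)‖ := rfl

variable (D : PrimitiveDatum Γ)

theorem PrimitiveDatum.one_lt_normMultiplier_axisT :
    1 < normMultiplier Γ D.frame D.axisT := by
  rw [normMultiplier_apply, D.multiplier_axisT, Units.val_pow_eq_pow_val, norm_pow]
  exact one_lt_pow₀ D.one_lt_norm two_ne_zero

theorem PrimitiveDatum.normMultiplier_axisE : normMultiplier Γ D.frame D.axisE = 1 := by
  rw [normMultiplier_apply, D.multiplier_axisE, Units.val_pow_eq_pow_val, norm_pow, D.norm_ζ,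
    one_pow]

theorem PrimitiveDatum.normMultiplier_zpow_mul_zpow (m n : ℤ) :
    normMultiplier Γ D.frame (D.axisT ^ m * D.axisE ^ n) =
      normMultiplier Γ D.frame D.axisT ^ m := by
  rw [map_mul, map_zpow, map_zpow, D.normMultiplier_axisE, one_zpow, mul_one]

theorem PrimitiveDatum.exists_degree : ∃ deg : axisGroup Γ D.frame →* Multiplicative ℤ,
    ∀ x, normMultiplier Γ D.frame x = normMultiplier Γ D.frame D.axisT ^ (deg x).toAdd := by
  refine SelbergZeta.exists_degree _ D.one_lt_normMultiplier_axisT fun x => ?_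
  obtain ⟨m, n, rfl⟩ := D.exists_zpow_mul_zpow x
  exact ⟨m, D.normMultiplier_zpow_mul_zpow m n⟩

theorem PrimitiveDatum.pow_orderOf_eq_one {x : axisGroup Γ D.frame}
    (hx : normMultiplier Γ D.frame x = 1) : x ^ orderOf D.axisE = 1 := by
  obtain ⟨m, n, rfl⟩ := D.exists_zpow_mul_zpow x
  rw [D.normMultiplier_zpow_mul_zpow] at hx
  have hm : m = 0 := by
    have h1 := D.one_lt_normMultiplier_axisT
    exact zpow_right_injective₀ (by linarith) h1.ne' (by simpa using hx)
  rw [hm, zpow_zero, one_mul, ← zpow_natCast, zpow_comm, zpow_natCast, _root_.pow_orderOf_eq_one,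
    one_zpow]

end Degree

/-! ### Passing between axes of Γ and axes of Γ₁. -/

section Covering

variable {Γ Γ₁ : Subgroup PSL(2, ℂ)}

/-- Transport of the group of an axis of `Γ₁` to a conjugate axis, in `Γ`. -/
def conjAxis (hle : Γ₁ ≤ Γ) {g g' : PSL(2, ℂ)} {γ : Γ} {c : ℂˣ} (h : g' = diagHom c * g * γ) :
    axisGroup Γ₁ g' →* axisGroup Γ g :=
  (((MulAut.conj γ).toMonoidHom.comp (Subgroup.inclusion hle)).comp
    (axisGroup Γ₁ g').subtype).codRestrict _ fun x => by
      obtain ⟨d, hd⟩ := exists_multiplier x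
      refine mem_axisGroup.2 ⟨d, ?_⟩
      have h1 : diagHom c * (g * ((γ * Subgroup.inclusion hle (x : Γ₁) * γ⁻¹ : Γ) : PSL(2, ℂ)) *
          g⁻¹) * (diagHom c)⁻¹ = diagHom d := by
        subst h
        rw [← hd]
        push_cast
        simp [mul_assoc]
      rw [mul_inv_eq_iff_eq_mul, ← map_mul, mul_comm d, map_mul] at h1
      exact mul_left_cancel h1

variable (hle : Γ₁ ≤ Γ) {g g' : PSL(2, ℂ)} {γ : Γ} {c : ℂˣ} (h : g' = diagHom c * g * γ)

theorem coe_conjAxis (x : axisGroup Γ₁ g') :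
    ((conjAxis hle h x : Γ) : PSL(2, ℂ)) = γ * (x : Γ₁) * (γ : PSL(2, ℂ))⁻¹ := rfl

theorem multiplier_conjAxis (x : axisGroup Γ₁ g') :
    multiplier Γ g (conjAxis hle h x) = multiplier Γ₁ g' x := by
  obtain ⟨d, hd⟩ := exists_multiplier x
  rw [multiplier_eq hd]
  apply multiplier_eq
  have h1 : diagHom c * (g * (conjAxis hle h x : Γ) * g⁻¹) * (diagHom c)⁻¹ = diagHom d := by
    subst h
    rw [← hd, coe_conjAxis]
    simp [mul_assoc]
  rw [mul_inv_eq_iff_eq_mul, ← map_mul, mul_comm d, map_mul] at h1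
  exact mul_left_cancel h1

theorem normMultiplier_conjAxis (x : axisGroup Γ₁ g') :
    normMultiplier Γ g (conjAxis hle h x) = normMultiplier Γ₁ g' x := by
  rw [normMultiplier_apply, multiplier_conjAxis, normMultiplier_apply]

theorem conjAxis_injective : Function.Injective (conjAxis hle h) := fun x y hxy =>
  multiplier_injective (by rw [← multiplier_conjAxis hle h, hxy, multiplier_conjAxis])

variable [(Γ₁.subgroupOf Γ).Normal]

theorem conjAxis_mem (x : axisGroup Γ₁ g') : (conjAxis hle h x : Γ) ∈ Γ₁.subgroupOf Γ :=
  (inferInstance : (Γ₁.subgroupOf Γ).Normal).conj_mem _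
    (Subgroup.mem_subgroupOf.2 (x : Γ₁).2) γ

theorem exists_conjAxis_eq {y : axisGroup Γ g} (hy : (y : Γ) ∈ Γ₁.subgroupOf Γ) :
    ∃ x, conjAxis hle h x = y := by
  have h1 := (inferInstance : (Γ₁.subgroupOf Γ).Normal).conj_mem _ hy γ⁻¹
  rw [Subgroup.mem_subgroupOf] at h1
  obtain ⟨d, hd⟩ := exists_multiplier y
  refine ⟨⟨⟨_, h1⟩, mem_axisGroup.2 ⟨d, ?_⟩⟩, ?_⟩
  · rw [h]
    have h2 : diagHom c * (g * (y : Γ) * g⁻¹) * (diagHom c)⁻¹ = diagHom d := by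
      rw [hd, ← map_mul, ← map_inv, ← map_mul, mul_inv_cancel_comm]
    rw [← h2]
    push_cast
    simp [mul_assoc]
  · apply Subtype.ext
    apply Subtype.ext
    rw [coe_conjAxis]
    push_cast
    simp [mul_assoc]

variable [(Γ₁.subgroupOf Γ).FiniteIndex]

/-- Below every axis of `Γ` there is a primitive element of `Γ₁`. -/
theorem exists_datum_below (hle : Γ₁ ≤ Γ) (D : PrimitiveDatum Γ) (γ : Γ) :
    ∃ (D' : PrimitiveDatum Γ₁) (c : ℂˣ), D'.frame = diagHom c * (D.frame * γ) := by
  have hfr : D.frame * γ = diagHom 1 * D.frame * γ := by rw [map_one, one_mul]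
  obtain ⟨deg, hdeg⟩ := D.exists_degree
  have h1 := D.one_lt_normMultiplier_axisT
  have hpow : ((D.axisT ^ (Γ₁.subgroupOf Γ).index : axisGroup Γ D.frame) : Γ) ∈ Γ₁.subgroupOf Γ :=
    Subgroup.pow_index_mem _ (D.axisT : Γ)
  obtain ⟨x, hx⟩ := exists_conjAxis_eq hle hfr hpow
  -- The degree is restricted from Γ. It is nonzero on the index-th power of T₀, which lies in Γ₁,
  -- and an element of degree zero is killed by the order of E.
  obtain ⟨T, E, hT, hE, hgen⟩ := exists_generators (multiplier_injective (Γ := Γ₁))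
    (deg.comp (conjAxis hle hfr)) (x := x) (M := orderOf D.axisE) (by
      intro h0
      rw [MonoidHom.comp_apply, hx] at h0
      have h2 := hdeg (D.axisT ^ (Γ₁.subgroupOf Γ).index)
      rw [h0, map_pow] at h2
      have h3 := one_lt_pow₀ h1 (Subgroup.FiniteIndex.index_ne_zero (H := Γ₁.subgroupOf Γ))
      rw [h2] at h3
      simp at h3) D.isOfFinOrder_axisE.orderOf_pos.ne' (by
      intro c hc
      apply conjAxis_injective hle hfr
      rw [map_pow, map_one]
      apply D.pow_orderOf_eq_one
      rw [MonoidHom.comp_apply] at hc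
      rw [hdeg, hc]
      simp)
  refine exists_primitiveDatum T E ?_ hE hgen
  rw [← normMultiplier_apply, ← normMultiplier_conjAxis hle hfr, hdeg]
  exact one_lt_zpow₀ h1 hT

/-- Above every axis of `Γ₁` there is a primitive element of `Γ`. -/
theorem exists_datum_above (hle : Γ₁ ≤ Γ) (D₁ : PrimitiveDatum Γ₁) :
    ∃ (D : PrimitiveDatum Γ) (c : ℂˣ), D.frame = diagHom c * D₁.frame := by
  have hfr : D₁.frame = diagHom 1 * D₁.frame * (1 : Γ) := by simp
  set n := (Γ₁.subgroupOf Γ).index with hn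
  have hn0 : n ≠ 0 := Subgroup.FiniteIndex.index_ne_zero
  have h1 := D₁.one_lt_normMultiplier_axisT
  have hpow : ∀ x : axisGroup Γ D₁.frame, ∃ y, conjAxis hle hfr y = x ^ n := fun x =>
    exists_conjAxis_eq hle hfr (Subgroup.pow_index_mem _ (x : Γ))
  -- For x in Γ only x^n is known to lie in Γ₁, so the degree is read off from the n-th power of the
  -- norm of the multiplier. This also explains the torsion bound n times the order of E₁ below.
  obtain ⟨deg, hdeg⟩ := exists_degree ((powMonoidHom n).comp (normMultiplier Γ D₁.frame)) h1
    (fun x => by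
      obtain ⟨y, hy⟩ := hpow x
      obtain ⟨m, k, rfl⟩ := D₁.exists_zpow_mul_zpow y
      refine ⟨m, ?_⟩
      rw [MonoidHom.comp_apply, powMonoidHom_apply, ← map_pow, ← hy, normMultiplier_conjAxis,
        D₁.normMultiplier_zpow_mul_zpow])
  simp only [MonoidHom.comp_apply, powMonoidHom_apply] at hdeg
  obtain ⟨T, E, hT, hE, hgen⟩ := exists_generators (multiplier_injective (Γ := Γ))
    deg (x := conjAxis hle hfr D₁.axisT) (M := n * orderOf D₁.axisE) (by
      intro h0
      have h2 := hdeg (conjAxis hle hfr D₁.axisT)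
      rw [h0, normMultiplier_conjAxis] at h2
      have h3 := one_lt_pow₀ h1 hn0
      rw [h2] at h3
      simp at h3) (mul_ne_zero hn0 D₁.isOfFinOrder_axisE.orderOf_pos.ne') (by
      intro x hx
      obtain ⟨y, hy⟩ := hpow x
      rw [pow_mul, ← hy, ← map_pow, D₁.pow_orderOf_eq_one, map_one]
      rw [← normMultiplier_conjAxis hle hfr, hy, map_pow, hdeg, hx]
      simp)
  refine exists_primitiveDatum T E ?_ hE hgen
  rw [← normMultiplier_apply]
  have h2 := one_lt_zpow₀ h1 hT
  rw [← hdeg] at h2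
  rw [normMultiplier_apply] at h2 ⊢
  exact (one_lt_pow_iff_of_nonneg (norm_nonneg _) hn0).1 h2

end Covering

/-! ### The local identity over one primitive element. -/

section LocalIdentity

variable {Γ Γ₁ : Subgroup PSL(2, ℂ)} [(Γ₁.subgroupOf Γ).Normal]

/-- The image of the group of an axis in the quotient group. -/
def axisImage (Γ Γ₁ : Subgroup PSL(2, ℂ)) [(Γ₁.subgroupOf Γ).Normal] (g : PSL(2, ℂ)) :
    Subgroup (Γ ⧸ Γ₁.subgroupOf Γ) :=
  (axisGroup Γ g).map (QuotientGroup.mk' (Γ₁.subgroupOf Γ))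

/-- The projection of the group of an axis to the quotient group. -/
def axisProj (Γ Γ₁ : Subgroup PSL(2, ℂ)) [(Γ₁.subgroupOf Γ).Normal] (g : PSL(2, ℂ)) :
    axisGroup Γ g →* axisImage Γ Γ₁ g :=
  (QuotientGroup.mk' (Γ₁.subgroupOf Γ)).subgroupMap (axisGroup Γ g)

theorem axisProj_surjective (g : PSL(2, ℂ)) : Function.Surjective (axisProj Γ Γ₁ g) :=
  MonoidHom.subgroupMap_surjective _ _

theorem coe_axisProj (g : PSL(2, ℂ)) (x : axisGroup Γ g) :
    (axisProj Γ Γ₁ g x : Γ ⧸ Γ₁.subgroupOf Γ) = ((x : Γ) : Γ ⧸ Γ₁.subgroupOf Γ) := rfl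

theorem axisProj_eq_one_iff (g : PSL(2, ℂ)) (x : axisGroup Γ g) :
    axisProj Γ Γ₁ g x = 1 ↔ (x : Γ) ∈ Γ₁.subgroupOf Γ := by
  rw [Subtype.ext_iff, coe_axisProj, OneMemClass.coe_one, QuotientGroup.eq_one_iff]

instance (g : PSL(2, ℂ)) : CommGroup (axisImage Γ Γ₁ g) where
  __ := (axisImage Γ Γ₁ g).toGroup
  mul_comm a b := by
    obtain ⟨x, rfl⟩ := axisProj_surjective g a
    obtain ⟨y, rfl⟩ := axisProj_surjective g b
    have h : x * y = y * x := multiplier_injective (by rw [map_mul, map_mul, mul_comm])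
    rw [← map_mul, ← map_mul, h]

/-- The kernel of the projection is the image of `conjAxis`, that is, the group of the axis of D₁
carried onto the axis of D, and it inherits the generators of D₁. -/
theorem isGeneratedBy_axis (hle : Γ₁ ≤ Γ) {D : PrimitiveDatum Γ} {D₁ : PrimitiveDatum Γ₁}
    {γ : Γ} {c : ℂˣ} (h : D₁.frame = diagHom c * D.frame * γ) :
    ∃ deg, IsGeneratedBy (axisProj Γ Γ₁ D.frame) deg D.axisT D.axisE
      (conjAxis hle h D₁.axisT) (conjAxis hle h D₁.axisE) := by
  obtain ⟨deg, hdeg⟩ := D.exists_degree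
  have h1 := D.one_lt_normMultiplier_axisT
  have hinj := zpow_right_injective₀ (zero_lt_one.trans h1) h1.ne'
  have hone : ∀ x, normMultiplier Γ D.frame x = 1 → deg x = 1 := fun x hx => by
    rw [hdeg] at hx
    exact hinj (hx.trans (zpow_zero _).symm)
  refine ⟨deg, axisProj_surjective _, D.exists_zpow_mul_zpow, ?_, hone _ D.normMultiplier_axisE,
    ?_, hone _ ?_, ?_, ?_, ?_⟩
  · exact hinj ((hdeg D.axisT).symm.trans (zpow_one _).symm)
  · have h2 := D₁.one_lt_normMultiplier_axisT
    rw [← normMultiplier_conjAxis hle h, hdeg] at h2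
    exact (one_lt_zpow_iff_right₀ h1).1 h2
  · rw [normMultiplier_conjAxis, D₁.normMultiplier_axisE]
  · rw [axisProj_eq_one_iff]
    exact conjAxis_mem hle h _
  · rw [axisProj_eq_one_iff]
    exact conjAxis_mem hle h _
  · intro x hx
    obtain ⟨y, rfl⟩ := exists_conjAxis_eq hle h ((axisProj_eq_one_iff _ _).1 hx)
    obtain ⟨m, n, rfl⟩ := D₁.exists_zpow_mul_zpow y
    exact ⟨m, n, by rw [map_mul, map_zpow, map_zpow]⟩

variable [(Γ₁.subgroupOf Γ).FiniteIndex]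

instance (g : PSL(2, ℂ)) : Finite (axisImage Γ Γ₁ g) :=
  inferInstance

/-- The values at `T₀` and `E` of a character of the image of the group of the axis. -/
def charPair (Γ₁ : Subgroup PSL(2, ℂ)) [(Γ₁.subgroupOf Γ).Normal] (D : PrimitiveDatum Γ)
    (ψ : AddChar (Additive (axisImage Γ Γ₁ D.frame)) ℂ) : ℂ × ℂ :=
  (ψ (Additive.ofMul (axisProj Γ Γ₁ D.frame D.axisT)),
    ψ (Additive.ofMul (axisProj Γ Γ₁ D.frame D.axisE)))

theorem prod_eulerFactor_charPair (hle : Γ₁ ≤ Γ) {D : PrimitiveDatum Γ} {D₁ : PrimitiveDatum Γ₁}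
    {γ : Γ} {c : ℂˣ} (h : D₁.frame = diagHom c * D.frame * γ) (s : ℂ) (l k : ℕ) :
    ∏ ψ, eulerFactor s D l k (charPair Γ₁ D ψ) = eulerFactor s D₁ l k (1, 1) := by
  obtain ⟨deg, hgen⟩ := isGeneratedBy_axis hle h
  have key := hgen.prod_twist ((quasiChar s l k).comp (multiplier Γ D.frame))
  simp only [twist_apply, MonoidHom.comp_apply, multiplier_conjAxis,
    PrimitiveDatum.multiplier_axisT, PrimitiveDatum.multiplier_axisE] at key
  simp only [eulerFactor, charPair, one_mul]
  convert key using 2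
  rfl

theorem eulerNorm_le_sum_charPair (hle : Γ₁ ≤ Γ) {D : PrimitiveDatum Γ} {D₁ : PrimitiveDatum Γ₁}
    {γ : Γ} {c : ℂˣ} (h : D₁.frame = diagHom c * D.frame * γ) {s : ℂ}
    (hs : -1 < s.re) (l k : ℕ) :
    eulerNorm s D₁ l k (1, 1) ≤ ∑ ψ, eulerNorm s D l k (charPair Γ₁ D ψ) := by
  obtain ⟨deg, hgen⟩ := isGeneratedBy_axis hle h
  have key := hgen.norm_le_sum_twist (φ := (quasiChar s l k).comp (multiplier Γ D.frame)) (by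
    rw [MonoidHom.comp_apply, multiplier_conjAxis]
    exact norm_quasiChar_le hs l k D₁.one_lt_normMultiplier_axisT.le)
  simp only [twist_apply, MonoidHom.comp_apply, multiplier_conjAxis,
    PrimitiveDatum.multiplier_axisT, PrimitiveDatum.multiplier_axisE] at key
  simp only [eulerNorm, charPair, one_mul]
  convert key using 2
  rfl

variable {n : ℕ} {α : Fin n → Γ} (hα : IsRightTransversal Γ₁ α)

theorem exists_equiv_jointEigenvalues_inducedRep (D : PrimitiveDatum Γ) :
    ∃ σ : Fin (Module.finrank ℂ (Fin n → ℂ)) ≃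
        Fin (Module.finrank ℂ (Γ ⧸ Γ₁.subgroupOf Γ → ℂ)),
      ∀ j, jointEigenvalues (rightRegular (Γ ⧸ Γ₁.subgroupOf Γ) D.T₀)
          (rightRegular (Γ ⧸ Γ₁.subgroupOf Γ) D.E) (σ j) =
        jointEigenvalues (inducedRep (Representation.trivial ℂ Γ₁ ℂ) α hα D.T₀)
          (inducedRep (Representation.trivial ℂ Γ₁ ℂ) α hα D.E) j := by
  obtain ⟨e, he⟩ := exists_equiv_inducedRep_trivial hα
  refine exists_equiv_jointEigenvalues_congr (N := Nat.card (Γ ⧸ Γ₁.subgroupOf Γ))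
    Nat.card_pos.ne' ?_ ?_ ?_ e (he _) (he _)
  · rw [← map_pow, pow_card_eq_one', map_one]
  · rw [← map_pow, pow_card_eq_one', map_one]
  · exact (D.commute_T₀_E.map (QuotientGroup.mk' _)).map (rightRegular _)

/-- The regular representation of the quotient, restricted to the image of the centralizer, contains
every character ψ as often as the index of that image. -/
theorem localProd_inducedRep (s : ℂ) (D : PrimitiveDatum Γ) (l k : ℕ) :
    localProd (inducedRep (Representation.trivial ℂ Γ₁ ℂ) α hα) s D l k =
      (∏ ψ, eulerFactor s D l k (charPair Γ₁ D ψ)) ^ (axisImage Γ Γ₁ D.frame).index := by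
  obtain ⟨σ, hσ⟩ := exists_equiv_jointEigenvalues_inducedRep hα D
  have key := prod_jointEigenvalues_rightRegular
    (Subgroup.subtype_injective (axisImage Γ Γ₁ D.frame)) (axisProj Γ Γ₁ D.frame D.axisT)
    (axisProj Γ Γ₁ D.frame D.axisE) (eulerFactor s D l k)
  rw [Subgroup.range_subtype] at key
  rw [localProd_eq, ← Finset.prod_congr rfl fun j _ => congrArg (eulerFactor s D l k) (hσ j),
    σ.prod_comp fun j => eulerFactor s D l k (jointEigenvalues
      (rightRegular (Γ ⧸ Γ₁.subgroupOf Γ) D.T₀) (rightRegular (Γ ⧸ Γ₁.subgroupOf Γ) D.E) j)]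
  exact key

theorem localSum_inducedRep (s : ℂ) (D : PrimitiveDatum Γ) (l k : ℕ) :
    localSum (inducedRep (Representation.trivial ℂ Γ₁ ℂ) α hα) s D l k =
      (axisImage Γ Γ₁ D.frame).index • ∑ ψ, eulerNorm s D l k (charPair Γ₁ D ψ) := by
  obtain ⟨σ, hσ⟩ := exists_equiv_jointEigenvalues_inducedRep hα D
  have key := sum_jointEigenvalues_rightRegular
    (Subgroup.subtype_injective (axisImage Γ Γ₁ D.frame)) (axisProj Γ Γ₁ D.frame D.axisT)
    (axisProj Γ Γ₁ D.frame D.axisE) (eulerNorm s D l k)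
  rw [Subgroup.range_subtype] at key
  rw [localSum_eq, ← Finset.sum_congr rfl fun j _ => congrArg (eulerNorm s D l k) (hσ j),
    σ.sum_comp fun j => eulerNorm s D l k (jointEigenvalues
      (rightRegular (Γ ⧸ Γ₁.subgroupOf Γ) D.T₀) (rightRegular (Γ ⧸ Γ₁.subgroupOf Γ) D.E) j)]
  exact key

theorem localProd_inducedRep_eq_prod {ι : Type*} [Fintype ι] {V : ι → Type*}
    [∀ i, NormedAddCommGroup (V i)] [∀ i, InnerProductSpace ℂ (V i)]
    [∀ i, FiniteDimensional ℂ (V i)]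
    {ϑ : ∀ i, Representation ℂ (Γ ⧸ Γ₁.subgroupOf Γ) (V i)} (hϑ : IsUnitaryDual ϑ)
    (s : ℂ) (D : PrimitiveDatum Γ) (l k : ℕ) :
    localProd (inducedRep (Representation.trivial ℂ Γ₁ ℂ) α hα) s D l k =
      ∏ i, localProd ((ϑ i).comp (QuotientGroup.mk' (Γ₁.subgroupOf Γ))) s D l k ^
        Module.finrank ℂ (V i) := by
  obtain ⟨σ, hσ⟩ := exists_equiv_jointEigenvalues_inducedRep hα D
  have key := hϑ.prod_jointEigenvalues_rightRegular
    (D.commute_T₀_E.map (QuotientGroup.mk' (Γ₁.subgroupOf Γ))) (eulerFactor s D l k)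
  rw [localProd_eq, ← Finset.prod_congr rfl fun j _ => congrArg (eulerFactor s D l k) (hσ j),
    σ.prod_comp fun j => eulerFactor s D l k (jointEigenvalues
      (rightRegular (Γ ⧸ Γ₁.subgroupOf Γ) D.T₀) (rightRegular (Γ ⧸ Γ₁.subgroupOf Γ) D.E) j)]
  simp only [localProd_eq]
  exact key

end LocalIdentity

/-! ### Counting the primitive classes of Γ₁ over one of Γ. -/

section Fibre

variable {Γ Γ₁ : Subgroup PSL(2, ℂ)} [(Γ₁.subgroupOf Γ).Normal] [(Γ₁.subgroupOf Γ).FiniteIndex]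

theorem exists_mem_frame_eq (hle : Γ₁ ≤ Γ) (R : ReducedSystem Γ) (D₁ : PrimitiveDatum Γ₁) :
    ∃ D : R.carrier, ∃ (γ : Γ) (c : ℂˣ), D₁.frame = diagHom c * D.1.frame * γ := by
  obtain ⟨D', c, hc⟩ := exists_datum_above hle D₁
  obtain ⟨D, hD, hDD'⟩ := R.maximal D'
  obtain ⟨δ, d, hd⟩ := (axisEquiv_iff _ _).1 hDD'
  refine ⟨⟨D, hD⟩, δ⁻¹, (d * c)⁻¹, ?_⟩
  change D₁.frame = diagHom (d * c)⁻¹ * D.frame * _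
  rw [hd, hc, map_inv, map_mul]
  push_cast
  group

variable {R : ReducedSystem Γ} {R₁ : ReducedSystem Γ₁} {p : R₁.carrier → R.carrier}

theorem eq_of_frame_eq {D D' : R.carrier} {γ γ' : Γ} {c c' : ℂˣ}
    (h : diagHom c * D.1.frame * γ = diagHom c' * D'.1.frame * γ') : D = D' := by
  refine Subtype.ext (R.reduced _ D.2 _ D'.2 ((axisEquiv_iff _ _).2 ⟨γ * γ'⁻¹, c'⁻¹ * c, ?_⟩))
  have h1 : D'.1.frame = (diagHom c')⁻¹ * (diagHom c' * D'.1.frame * γ') *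
      (γ' : PSL(2, ℂ))⁻¹ := by group
  rw [h1, ← h, map_mul, map_inv]
  push_cast
  group

/-- In D₁.frame = diag(c) · D.frame · γ, the element γ is determined up to left multiplication by
the axis group of D. Passing to an equivalent datum of Γ₁ multiplies γ on the right by Γ₁. The fibre
is therefore a double coset space, which by normality is a coset space of the quotient group. -/
theorem bijective_fibre (hle : Γ₁ ≤ Γ)
    (hp : ∀ D₁ : R₁.carrier, ∃ (γ : Γ) (c : ℂˣ), D₁.1.frame = diagHom c * (p D₁).1.frame * γ)
    (D : R.carrier) :
    ∃ f : {D₁ // p D₁ = D} → (Γ ⧸ Γ₁.subgroupOf Γ) ⧸ axisImage Γ Γ₁ D.1.frame,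
      Function.Bijective f := by
  choose γ c hγ using hp
  -- The inverse of γ is taken because γ is ambiguous on the left while the quotient consists of
  -- left cosets.
  refine ⟨fun D₁ => (((γ D₁.1 : Γ ⧸ Γ₁.subgroupOf Γ)⁻¹ : Γ ⧸ Γ₁.subgroupOf Γ) :
    (Γ ⧸ Γ₁.subgroupOf Γ) ⧸ axisImage Γ Γ₁ D.1.frame), ?_, ?_⟩
  · rintro ⟨D₁, rfl⟩ ⟨D₂, h2⟩ heq
    simp only at heq
    rw [QuotientGroup.eq, inv_inv] at heq
    obtain ⟨x, hx, hx'⟩ := heq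
    have hx1 : ((γ D₁ * (γ D₂)⁻¹ : Γ) : Γ ⧸ Γ₁.subgroupOf Γ) = (x : Γ ⧸ Γ₁.subgroupOf Γ) := by
      rw [QuotientGroup.mk_mul, QuotientGroup.mk_inv]
      exact hx'.symm
    obtain ⟨d, hd⟩ := mem_axisGroup.1 hx
    have hmem : ((γ D₁)⁻¹ * x * γ D₂ : Γ) ∈ Γ₁.subgroupOf Γ := by
      rw [← QuotientGroup.eq_one_iff, QuotientGroup.mk_mul, QuotientGroup.mk_mul, ← hx1,
        QuotientGroup.mk_mul, QuotientGroup.mk_inv, QuotientGroup.mk_inv]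
      group
    rw [Subgroup.mem_subgroupOf] at hmem
    have hfr : D₂.1.frame = diagHom (c D₂ * d⁻¹ * (c D₁)⁻¹) * D₁.1.frame *
        ((⟨_, hmem⟩ : Γ₁) : PSL(2, ℂ)) := by
      rw [hγ D₂, h2, hγ D₁]
      simp only [map_mul, map_inv, ← hd]
      push_cast
      group
    have := R₁.reduced _ D₁.2 _ D₂.2 ((axisEquiv_iff _ _).2 ⟨_, _, hfr⟩)
    exact Subtype.ext (Subtype.ext this)
  · intro q
    obtain ⟨y, rfl⟩ := QuotientGroup.mk_surjective q
    obtain ⟨δ, hδ⟩ := QuotientGroup.mk_surjective y⁻¹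
    obtain ⟨D', d, hd⟩ := exists_datum_below hle D.1 δ
    obtain ⟨D₁, hD₁, hD'⟩ := R₁.maximal D'
    obtain ⟨ε, e, he⟩ := (axisEquiv_iff _ _).1 hD'
    have hfr : D₁.frame = diagHom (e * d) * D.1.frame *
        ((δ * ⟨ε, hle ε.2⟩ : Γ) : PSL(2, ℂ)) := by
      rw [he, hd, map_mul]
      push_cast
      group
    have hpD : p ⟨D₁, hD₁⟩ = D := eq_of_frame_eq ((hγ ⟨D₁, hD₁⟩).symm.trans hfr)
    refine ⟨⟨⟨D₁, hD₁⟩, hpD⟩, ?_⟩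
    simp only
    rw [QuotientGroup.eq, inv_inv]
    have hγD := hγ ⟨D₁, hD₁⟩
    rw [hpD] at hγD
    set γ₁ := γ ⟨D₁, hD₁⟩
    set c₁ := c ⟨D₁, hD₁⟩
    refine ⟨γ₁ * (δ * ⟨ε, hle ε.2⟩ : Γ)⁻¹, mem_axisGroup.2 ⟨c₁⁻¹ * (e * d), ?_⟩, ?_⟩
    · have h1 := hγD.symm.trans hfr
      have h3 : D.1.frame * γ₁ = (diagHom c₁)⁻¹ * (diagHom (e * d) * D.1.frame *
          ((δ * ⟨ε, hle ε.2⟩ : Γ) : PSL(2, ℂ))) := by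
        rw [← h1]
        group
      rw [Subgroup.coe_mul, ← mul_assoc, h3, map_mul diagHom c₁⁻¹, map_inv, Subgroup.coe_inv]
      group
    · have hε : (((⟨ε, hle ε.2⟩ : Γ)) : Γ ⧸ Γ₁.subgroupOf Γ) = 1 :=
        (QuotientGroup.eq_one_iff _).2 (Subgroup.mem_subgroupOf.2 ε.2)
      rw [QuotientGroup.mk'_apply, QuotientGroup.mk_mul, QuotientGroup.mk_inv,
        QuotientGroup.mk_mul, hε, hδ, mul_one, inv_inv]

end Fibre

/-! ### Assembling the local identities. -/

section Main

/-- Regrouping of the index set of the Euler product along the fibres of a map. -/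
def fibreEquiv {X X₁ : Type*} (p : X₁ → X) :
    (Σ x : X × ℕ × ℕ, {y : X₁ // p y = x.1}) ≃ X₁ × ℕ × ℕ where
  toFun z := (z.2.1, z.1.2)
  invFun y := ⟨(p y.1, y.2), y.1, rfl⟩
  left_inv := by
    rintro ⟨⟨x, l, k⟩, y, h⟩
    simp only at h
    subst h
    rfl
  right_inv _ := rfl

variable {Γ Γ₁ : Subgroup PSL(2, ℂ)} [(Γ₁.subgroupOf Γ).Normal] [(Γ₁.subgroupOf Γ).FiniteIndex]
  {R : ReducedSystem Γ} {R₁ : ReducedSystem Γ₁} {s : ℂ}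
  {n : ℕ} {α : Fin n → Γ} {hα : IsRightTransversal Γ₁ α}

theorem ZetaConverges.of_comp_mk {V : Type*} [AddCommGroup V] [Module ℂ V]
    (h : ZetaConverges R (Representation.trivial ℂ Γ ℂ) s)
    (ϑ : Representation ℂ (Γ ⧸ Γ₁.subgroupOf Γ) V) :
    ZetaConverges R (ϑ.comp (QuotientGroup.mk' (Γ₁.subgroupOf Γ))) s := by
  refine h.of_trivial fun D j => norm_jointEigenvalues_fst_le
    (N := Nat.card (Γ ⧸ Γ₁.subgroupOf Γ)) Nat.card_pos.ne' ?_ j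
  rw [MonoidHom.comp_apply, ← map_pow, pow_card_eq_one', map_one]

theorem ZetaConverges.inducedRep (h : ZetaConverges R (Representation.trivial ℂ Γ ℂ) s) :
    ZetaConverges R (inducedRep (Representation.trivial ℂ Γ₁ ℂ) α hα) s := by
  refine h.of_trivial fun D j => norm_jointEigenvalues_fst_le
    (N := Nat.card (Γ ⧸ Γ₁.subgroupOf Γ)) Nat.card_pos.ne' ?_ j
  obtain ⟨e, he⟩ := exists_equiv_inducedRep_trivial hα
  refine LinearMap.ext fun v => ?_
  apply e.injective
  rw [← map_pow, he, QuotientGroup.mk_pow, pow_card_eq_one', map_one]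
  rfl

/-- The Euler product of `Z(s, Γ₁, 1)`, grouped over that of `Z(s, Γ, U¹)`. -/
theorem zetaConverges_and_selbergZeta_eq (hle : Γ₁ ≤ Γ) (hs : -1 < s.re)
    (hU : ZetaConverges R (SelbergZeta.inducedRep (Representation.trivial ℂ Γ₁ ℂ) α hα) s) :
    ZetaConverges R₁ (Representation.trivial ℂ Γ₁ ℂ) s ∧
      selbergZeta R₁ (Representation.trivial ℂ Γ₁ ℂ) s =
        selbergZeta R (SelbergZeta.inducedRep (Representation.trivial ℂ Γ₁ ℂ) α hα) s := by
  choose p γ c hp using fun D₁ : R₁.carrier => exists_mem_frame_eq hle R D₁.1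
  have hfib : ∀ D : R.carrier, Finite {D₁ // p D₁ = D} ∧
      Nat.card {D₁ // p D₁ = D} = (axisImage Γ Γ₁ D.1.frame).index := fun D => by
    obtain ⟨f, hf⟩ := bijective_fibre hle (fun D₁ => ⟨γ D₁, c D₁, hp D₁⟩) D
    exact ⟨Finite.of_injective f hf.1, Nat.card_eq_of_bijective f hf⟩
  have : ∀ D, Fintype {D₁ // p D₁ = D} := fun D =>
    have := (hfib D).1
    Fintype.ofFinite _
  have hcard : ∀ D, Fintype.card {D₁ // p D₁ = D} = (axisImage Γ Γ₁ D.1.frame).index := fun D => by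
    rw [← (hfib D).2, Nat.card_eq_fintype_card]
  have hconv : ZetaConverges R₁ (Representation.trivial ℂ Γ₁ ℂ) s := by
    rw [zetaConverges_iff] at hU ⊢
    rw [← (fibreEquiv p).summable_iff]
    refine (summable_sigma_of_nonneg fun _ => localSum_nonneg _ _ _ _ _).2 ?_
    refine ⟨fun _ => Summable.of_finite, ?_⟩
    simp only [tsum_fintype]
    refine Summable.of_nonneg_of_le (fun x => Finset.sum_nonneg fun _ _ =>
      localSum_nonneg _ _ _ _ _) (fun x => ?_) hU
    obtain ⟨D, l, k⟩ := x
    -- The index in the local sum is the size of the fibre, so it is enough to bound each member of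
    -- the fibre by the sum over ψ.
    rw [localSum_inducedRep hα, ← hcard]
    refine Finset.sum_le_card_nsmul _ _ _ fun D₁ _ => ?_
    obtain ⟨D₁, hD₁⟩ := D₁
    change p D₁ = D at hD₁
    subst hD₁
    change localSum (Representation.trivial ℂ Γ₁ ℂ) s D₁.1 l k ≤ _
    rw [localSum_trivial_eq]
    exact eulerNorm_le_sum_charPair hle (hp D₁) hs l k
  refine ⟨hconv, ?_⟩
  have h1 := hasProd_selbergZeta hconv
  rw [← (fibreEquiv p).hasProd_iff] at h1
  -- The product over Γ₁, multiplied fibre by fibre, has the same local factors as the product of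
  -- the induced representation.
  refine HasProd.unique (h1.sigma (g := fun x : R.carrier × ℕ × ℕ =>
    localProd (SelbergZeta.inducedRep (Representation.trivial ℂ Γ₁ ℂ) α hα) s x.1 x.2.1 x.2.2)
    fun x => ?_) (hasProd_selbergZeta hU)
  obtain ⟨D, l, k⟩ := x
  have h2 : ∀ D₁ : {D₁ // p D₁ = D}, localProd (Representation.trivial ℂ Γ₁ ℂ) s D₁.1.1 l k =
      ∏ ψ, eulerFactor s D.1 l k (charPair Γ₁ D.1 ψ) := by
    rintro ⟨D₁, rfl⟩
    rw [localProd_trivial, prod_eulerFactor_charPair hle (hp D₁)]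
  have h3 : localProd (SelbergZeta.inducedRep (Representation.trivial ℂ Γ₁ ℂ) α hα) s D.1 l k =
      ∏ D₁ : {D₁ // p D₁ = D}, localProd (Representation.trivial ℂ Γ₁ ℂ) s D₁.1.1 l k := by
    rw [localProd_inducedRep hα, Finset.prod_congr rfl fun D₁ _ => h2 D₁, Finset.prod_const,
      Finset.card_univ, hcard]
  simp only [h3]
  exact hasProd_fintype _

theorem selbergZeta_inducedRep_eq_prod {ι : Type*} [Fintype ι] {V : ι → Type*}
    [∀ i, NormedAddCommGroup (V i)] [∀ i, InnerProductSpace ℂ (V i)]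
    [∀ i, FiniteDimensional ℂ (V i)]
    {ϑ : ∀ i, Representation ℂ (Γ ⧸ Γ₁.subgroupOf Γ) (V i)} (hϑ : IsUnitaryDual ϑ)
    (h : ZetaConverges R (Representation.trivial ℂ Γ ℂ) s) :
    selbergZeta R (SelbergZeta.inducedRep (Representation.trivial ℂ Γ₁ ℂ) α hα) s =
      ∏ i, selbergZeta R ((ϑ i).comp (QuotientGroup.mk' (Γ₁.subgroupOf Γ))) s ^
        Module.finrank ℂ (V i) := by
  refine (hasProd_selbergZeta h.inducedRep).unique ?_
  simp only [localProd_inducedRep_eq_prod hα hϑ]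
  exact hasProd_prod fun i _ => (hasProd_selbergZeta (h.of_comp_mk (ϑ i))).pow _

end Main

end SelbergZeta

end

theorem mainTheorem2
    (Γ Γ₁ : Subgroup PSL(2, ℂ)) [DiscreteTopology Γ] (hle : Γ₁ ≤ Γ)
    [(Γ₁.subgroupOf Γ).Normal] [(Γ₁.subgroupOf Γ).FiniteIndex]
    (R : SelbergZeta.ReducedSystem Γ) (R₁ : SelbergZeta.ReducedSystem Γ₁)
    {n : ℕ} (α : Fin n → Γ) (hα : SelbergZeta.IsRightTransversal Γ₁ α)
    {ι : Type*} {V : ι → Type*} [∀ i, NormedAddCommGroup (V i)]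
    [∀ i, InnerProductSpace ℂ (V i)] [∀ i, FiniteDimensional ℂ (V i)]
    (ϑ : ∀ i, Representation ℂ (Γ ⧸ Γ₁.subgroupOf Γ) (V i))
    (hϑ : SelbergZeta.IsUnitaryDual ϑ)
    (s : ℂ) (hs : 1 < s.re)
    (hconv : SelbergZeta.ZetaConverges R (Representation.trivial ℂ Γ ℂ) s) :
    SelbergZeta.ZetaConverges R₁ (Representation.trivial ℂ Γ₁ ℂ) s ∧
    SelbergZeta.ZetaConverges R
      (SelbergZeta.inducedRep (Representation.trivial ℂ Γ₁ ℂ) α hα) s ∧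
    (∀ i, SelbergZeta.ZetaConverges R
      ((ϑ i).comp (QuotientGroup.mk' (Γ₁.subgroupOf Γ))) s) ∧
    Finite ι ∧
    SelbergZeta.selbergZeta R₁ (Representation.trivial ℂ Γ₁ ℂ) s =
      SelbergZeta.selbergZeta R
        (SelbergZeta.inducedRep (Representation.trivial ℂ Γ₁ ℂ) α hα) s ∧
    SelbergZeta.selbergZeta R
        (SelbergZeta.inducedRep (Representation.trivial ℂ Γ₁ ℂ) α hα) s =
      ∏ᶠ i, SelbergZeta.selbergZeta R
        ((ϑ i).comp (QuotientGroup.mk' (Γ₁.subgroupOf Γ))) s ^ Module.finrank ℂ (V i) := by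
  have hfin : Finite ι := hϑ.finite
  have := Fintype.ofFinite ι
  have hU : SelbergZeta.ZetaConverges R
      (SelbergZeta.inducedRep (Representation.trivial ℂ Γ₁ ℂ) α hα) s := hconv.inducedRep
  obtain ⟨h₁, heq⟩ := SelbergZeta.zetaConverges_and_selbergZeta_eq (R₁ := R₁) hle
    (by linarith) hU
  refine ⟨h₁, hU, fun i => hconv.of_comp_mk (ϑ i), hfin, heq, ?_⟩
  rw [finprod_eq_prod_of_fintype]
  exact SelbergZeta.selbergZeta_inducedRep_eq_prod hϑ hconv
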